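/- Let $A$ be a finite abelian group, let $\chi : A\times A\to U(1)$ be a nondegenerate symmetric bicharacter, and let $\xi\in\{\pm1\}$. Let $\mathrm{TY}(A,\chi,\xi)$ be the Tambara–Yamagami fusion category over $\mathbb C$: its simple objects are the elements $a\in A$ and one further object $\tau$, its fusion rules are $a\otimes b=ab$, $a\otimes\tau=\tau=\tau\otimes a$, $\tau\otimes\tau=\bigoplus_{a\in A}a$, and its associators $(x\otimes y)\otimes z\to x\otimes(y\otimes z)$ on simple objects are $\chi(a,b)\,\mathrm{id}_\tau$ for $(a,\tau,b)$, $\bigoplus_{b\in A}\chi(a,b)\,\mathrm{id}_b$ for $(\tau,a,\tau)$, the matrix $\bigl(\tfrac{\xi}{\sqrt{|A|}}\chi(a,b)^{-1}\,\mathrm{id}_\tau\bigr)_{a,b\in A}$ for $(\tau,\tau,\tau)$, and identities in all other cases. The unitary structure of $\mathrm{TY}(A,\chi,\xi)$ is unique up to unitary monoidal equivalence: if $\mathcal C_1$ and $\mathcal C_2$ are unitary fusion categories (fusion categories over $\mathbb C$ with a $C^*$-structure for which $(f\otimes g)^*=f^*\otimes g^*$ and the associators and unitors are unitary), each of which is equivalent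 to $\mathrm{TY}(A,\chi,\xi)$ as a $\mathbb C$-linear monoidal category, then there is a $\mathbb C$-linear monoidal equivalence $F:\mathcal C_1\to\mathcal C_2$ with $F(f^*)=F(f)^*$ for all morphisms $f$ and with unitary structure morphisms $F(X)\otimes F(Y)\to F(X\otimes Y)$ and $\mathbf 1\to F(\mathbf 1)$. -/

import Mathlib

open CategoryTheory MonoidalCategory
open scoped ComplexConjugate

universe u v u₁ v₁ u₂ v₂

noncomputable section

namespace TambaraYamagami

/-- A dagger category: every morphism `f : X ⟶ Y` has an adjoint `dag f : Y ⟶ X`. -/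
class DaggerCategory (C : Type u) [Category.{v} C] where
  dag : ∀ {X Y : C}, (X ⟶ Y) → (Y ⟶ X)
  dag_id : ∀ X : C, dag (𝟙 X) = 𝟙 X
  dag_comp : ∀ {X Y Z : C} (f : X ⟶ Y) (g : Y ⟶ Z), dag (f ≫ g) = dag g ≫ dag f
  dag_dag : ∀ {X Y : C} (f : X ⟶ Y), dag (dag f) = f

open DaggerCategory

/-- A morphism of a dagger category is unitary if its adjoint is its inverse. -/
def IsUnitaryHom {C : Type u} [Category.{v} C] [DaggerCategory C] {X Y : C} (f : X ⟶ Y) : Prop :=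
  f ≫ dag f = 𝟙 X ∧ dag f ≫ f = 𝟙 Y

/-- A `ℂ`-linear dagger category is a `C*`-category if the adjoint is conjugate linear, the morphism
spaces carry a submultiplicative norm with the `C*`-identity, and each `f ≫ dag f` is a positive
element of the endomorphism algebra. (Completeness of the norms is automatic for finite-dimensional
morphism spaces, which are the only ones that occur below.) -/
class CStarCategory (C : Type u) [Category.{v} C] [Preadditive C] [Linear ℂ C]
    [DaggerCategory C] : Prop where
  dag_add : ∀ {X Y : C} (f g : X ⟶ Y), dag (f + g) = dag f + dag g
  dag_smul : ∀ {X Y : C} (c : ℂ) (f : X ⟶ Y), dag (c • f) = conj c • dag f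
  exists_norm : ∃ ν : ∀ {X Y : C}, (X ⟶ Y) → ℝ,
    (∀ {X Y : C} (f : X ⟶ Y), 0 ≤ ν f ∧ (ν f = 0 ↔ f = 0)) ∧
    (∀ {X Y : C} (f g : X ⟶ Y), ν (f + g) ≤ ν f + ν g) ∧
    (∀ {X Y : C} (c : ℂ) (f : X ⟶ Y), ν (c • f) = ‖c‖ * ν f) ∧
    (∀ {X Y Z : C} (f : X ⟶ Y) (g : Y ⟶ Z), ν (f ≫ g) ≤ ν f * ν g) ∧
    (∀ {X Y : C} (f : X ⟶ Y), ν (f ≫ dag f) = ν f ^ 2)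
  exists_comp_dag_eq : ∀ {X Y : C} (f : X ⟶ Y), ∃ g : X ⟶ X, f ≫ dag f = g ≫ dag g

/-- A simple object of a fusion category over `ℂ`: a nonzero object all of whose endomorphisms are
scalars. -/
def IsSimpleObj {C : Type u} [Category.{v} C] [Preadditive C] [Linear ℂ C] (X : C) : Prop :=
  𝟙 X ≠ 0 ∧ ∀ f : X ⟶ X, ∃ c : ℂ, f = c • 𝟙 X

/-- A fusion category over `ℂ`: a `ℂ`-linear monoidal category with finite direct sums, a simple
unit object, left and right duals, and finitely many simple objects without nonzero morphisms
between different ones, such that every object is a finite direct sum of these. -/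
class FusionCategory (C : Type u) [Category.{v} C] [Preadditive C] [Linear ℂ C]
    [MonoidalCategory C] : Prop extends MonoidalPreadditive C, MonoidalLinear ℂ C,
    Limits.HasFiniteBiproducts C where
  simple_unit : IsSimpleObj (𝟙_ C)
  semisimple : ∃ (m : ℕ) (S : Fin m → C), (∀ i, IsSimpleObj (S i)) ∧
    (∀ i j, i ≠ j → ∀ f : S i ⟶ S j, f = 0) ∧
    ∀ X : C, ∃ (n : ℕ) (c : Fin n → Fin m),
      Nonempty (X ≅ Limits.biproduct fun k => S (c k))
  rigid : ∀ X : C, (∃ Y : C, Nonempty (ExactPairing X Y)) ∧ ∃ Y : C, Nonempty (ExactPairing Y X)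

/-- A unitary fusion category: a fusion category that is a `C*`-category such that the tensor product
of morphisms is compatible with adjoints and the associators and unitors are unitary. -/
class UnitaryFusionCategory (C : Type u) [Category.{v} C] [Preadditive C] [Linear ℂ C]
    [MonoidalCategory C] [DaggerCategory C] : Prop extends FusionCategory C, CStarCategory C where
  dag_tensor : ∀ {X₁ Y₁ X₂ Y₂ : C} (f : X₁ ⟶ Y₁) (g : X₂ ⟶ Y₂),
    dag (f ⊗ₘ g) = dag f ⊗ₘ dag g
  associator_unitary : ∀ X Y Z : C, IsUnitaryHom (α_ X Y Z).hom
  leftUnitor_unitary : ∀ X : C, IsUnitaryHom (λ_ X).hom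
  rightUnitor_unitary : ∀ X : C, IsUnitaryHom (ρ_ X).hom

/-- Equivalence of `ℂ`-linear monoidal categories (without regard to adjoints). -/
def MonoidallyEquivalent (C : Type u₁) [Category.{v₁} C] [Preadditive C] [Linear ℂ C]
    [MonoidalCategory C] (D : Type u₂) [Category.{v₂} D] [Preadditive D] [Linear ℂ D]
    [MonoidalCategory D] : Prop :=
  ∃ (F : C ⥤ D) (_ : F.Monoidal), F.IsEquivalence ∧ F.Additive ∧ F.Linear ℂ

/-- Unitary monoidal equivalence: a `ℂ`-linear monoidal equivalence that preserves adjoints and whose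
structure morphisms `F X ⊗ F Y ⟶ F (X ⊗ Y)` and `𝟙 ⟶ F 𝟙` are unitary. -/
def UnitarilyMonoidallyEquivalent (C : Type u₁) [Category.{v₁} C] [Preadditive C] [Linear ℂ C]
    [MonoidalCategory C] [DaggerCategory C] (D : Type u₂) [Category.{v₂} D] [Preadditive D]
    [Linear ℂ D] [MonoidalCategory D] [DaggerCategory D] : Prop :=
  ∃ (F : C ⥤ D) (_ : F.Monoidal), F.IsEquivalence ∧ F.Additive ∧ F.Linear ℂ ∧
    (∀ {X Y : C} (f : X ⟶ Y), F.map (dag f) = dag (F.map f)) ∧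
    (∀ X Y : C, IsUnitaryHom (Functor.LaxMonoidal.μ F X Y)) ∧
    IsUnitaryHom (Functor.LaxMonoidal.ε F)

/-- A unitary multiplicity-free system of fusion rules and `F`-symbols on a finite set `L` of
labels: `c ∈ N a b` says that `c` occurs (once) in `a ⊗ b`, and `F x y z w e f` is the matrix entry
of the associator `(x ⊗ y) ⊗ z ⟶ x ⊗ (y ⊗ z)` between the copy of `w` in the source that goes
through `e` in `x ⊗ y` and the copy of `w` in the target that goes through `f` in `y ⊗ z`. The
axioms are the unit constraints, unitarity of the associators, and the pentagon equation. -/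
structure FusionSystem (L : Type u) [Fintype L] [DecidableEq L] where
  one : L
  N : L → L → Finset L
  F : L → L → L → L → L → L → ℂ
  N_one_left : ∀ x, N one x = {x}
  N_one_right : ∀ x, N x one = {x}
  F_eq_zero : ∀ x y z w e f,
    ¬ ((e ∈ N x y ∧ w ∈ N e z) ∧ (f ∈ N y z ∧ w ∈ N x f)) → F x y z w e f = 0
  F_one : ∀ x y w, w ∈ N x y → F x one y w x y = 1
  F_mul_star : ∀ x y z w e e', e ∈ N x y → w ∈ N e z →
    ∑ f, F x y z w e f * conj (F x y z w e' f) = if e = e' then 1 else 0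
  star_F_mul : ∀ x y z w f f', f ∈ N y z → w ∈ N x f →
    ∑ e, conj (F x y z w e f) * F x y z w e f' = if f = f' then 1 else 0
  pentagon : ∀ x y z t w e f h k,
    ∑ g, F x y z f e g * F x g t w f k * F y z t k g h = F e z t w f h * F x y h w e k

namespace FusionSystem

variable {L : Type u} [Fintype L] [DecidableEq L]

/-- An object of the category of a fusion system `S`: a finite direct sum of simple objects, given
by the family of their labels. -/
structure Obj (S : FusionSystem L) where
  ι : Type u
  [fintype : Fintype ι]
  [decEq : DecidableEq ι]
  l : ι → L

attribute [instance] Obj.fintype Obj.decEq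

variable {S : FusionSystem L}

/-- Morphisms are the complex matrices that have no entries between different labels. -/
def homs (X Y : S.Obj) : Submodule ℂ (Matrix X.ι Y.ι ℂ) where
  carrier := {M | ∀ i j, X.l i ≠ Y.l j → M i j = 0}
  add_mem' := fun ha hb i j h => by simp [ha i j h, hb i j h]
  zero_mem' := fun _ _ _ => rfl
  smul_mem' := fun c M hM i j h => by simp [hM i j h]

instance : Category.{u} S.Obj where
  Hom X Y := homs X Y
  id X := ⟨1, fun i j h => Matrix.one_apply_ne fun hij => h (hij ▸ rfl)⟩
  comp {X Y Z} f g := ⟨f.1 * g.1, fun i k h => by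
    rw [Matrix.mul_apply]
    refine Finset.sum_eq_zero fun j _ => ?_
    by_cases h1 : X.l i = Y.l j
    · rw [g.2 j k (h1 ▸ h), mul_zero]
    · rw [f.2 i j h1, zero_mul]⟩
  id_comp f := Subtype.ext (Matrix.one_mul f.1)
  comp_id f := Subtype.ext (Matrix.mul_one f.1)
  assoc f g h := Subtype.ext (Matrix.mul_assoc f.1 g.1 h.1)

/-- The matrix of a morphism. -/
def mat {X Y : S.Obj} (f : X ⟶ Y) : Matrix X.ι Y.ι ℂ := f.1

/-- The morphism with a given matrix. -/
def ofMat {X Y : S.Obj} (M : Matrix X.ι Y.ι ℂ) (hM : ∀ i j, X.l i ≠ Y.l j → M i j = 0) : X ⟶ Y :=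
  ⟨M, hM⟩

theorem mat_zero' {X Y : S.Obj} (f : X ⟶ Y) {i : X.ι} {j : Y.ι} (h : X.l i ≠ Y.l j) :
    mat f i j = 0 := f.2 i j h

theorem hom_ext' {X Y : S.Obj} {f g : X ⟶ Y} (h : ∀ i j, mat f i j = mat g i j) : f = g :=
  Subtype.ext (Matrix.ext h)

theorem mat_ofMat {X Y : S.Obj} (M : Matrix X.ι Y.ι ℂ) (hM) :
    mat (ofMat (X := X) (Y := Y) M hM) = M := rfl
theorem mat_id (X : S.Obj) : mat (𝟙 X) = 1 := rfl
theorem mat_comp {X Y Z : S.Obj} (f : X ⟶ Y) (g : Y ⟶ Z) : mat (f ≫ g) = mat f * mat g := rfl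

instance : Preadditive S.Obj where
  homGroup X Y := inferInstanceAs (AddCommGroup (homs X Y))
  add_comp _ _ _ f g h := Subtype.ext (Matrix.add_mul f.1 g.1 h.1)
  comp_add _ _ _ f g h := Subtype.ext (Matrix.mul_add f.1 g.1 h.1)

instance : Linear ℂ S.Obj where
  homModule X Y := inferInstanceAs (Module ℂ (homs X Y))
  smul_comp _ _ _ r f g := Subtype.ext (Matrix.smul_mul r f.1 g.1)
  comp_smul _ _ _ f r g := Subtype.ext (Matrix.mul_smul f.1 r g.1)

theorem mat_add {X Y : S.Obj} (f g : X ⟶ Y) : mat (f + g) = mat f + mat g := rfl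
theorem mat_zero {X Y : S.Obj} : mat (0 : X ⟶ Y) = 0 := rfl
theorem mat_smul {X Y : S.Obj} (c : ℂ) (f : X ⟶ Y) : mat (c • f) = c • mat f := rfl

/-- The tensor product: its index set consists of the triples `(i, j, c)` with `c` occurring in the
product of the labels of `i` and `j`, and the label of such a triple is `c`. -/
def tensor (X Y : S.Obj) : S.Obj where
  ι := {p : X.ι × Y.ι × L // p.2.2 ∈ S.N (X.l p.1) (Y.l p.2.1)}
  l p := p.1.2.2

/-- The first component of an index of a tensor product. -/
def fst {X Y : S.Obj} (p : (tensor X Y).ι) : X.ι := p.1.1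

/-- The second component. -/
def snd {X Y : S.Obj} (p : (tensor X Y).ι) : Y.ι := p.1.2.1

/-- The label. -/
def chan {X Y : S.Obj} (p : (tensor X Y).ι) : L := p.1.2.2

/-- The index with given components. -/
def index {X Y : S.Obj} (i : X.ι) (j : Y.ι) (c : L) (h : c ∈ S.N (X.l i) (Y.l j)) :
    (tensor X Y).ι := ⟨(i, j, c), h⟩

@[simp] theorem fst_mk {X Y : S.Obj} (i : X.ι) (j : Y.ι) (c : L) (h) :
    fst (index (X := X) (Y := Y) i j c h) = i := rfl
@[simp] theorem snd_mk {X Y : S.Obj} (i : X.ι) (j : Y.ι) (c : L) (h) :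
    snd (index (X := X) (Y := Y) i j c h) = j := rfl
@[simp] theorem chan_mk {X Y : S.Obj} (i : X.ι) (j : Y.ι) (c : L) (h) :
    chan (index (X := X) (Y := Y) i j c h) = c := rfl

theorem mem {X Y : S.Obj} (p : (tensor X Y).ι) : chan p ∈ S.N (X.l (fst p)) (Y.l (snd p)) := p.2

theorem tensor_l {X Y : S.Obj} (p : (tensor X Y).ι) : (tensor X Y).l p = chan p := rfl

theorem tensor_ext_iff {X Y : S.Obj} {p q : (tensor X Y).ι} :
    p = q ↔ fst p = fst q ∧ snd p = snd q ∧ chan p = chan q :=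
  Subtype.ext_iff.trans (Prod.ext_iff.trans (and_congr Iff.rfl Prod.ext_iff))

/-- The unit object. -/
def unit (S : FusionSystem L) : S.Obj where
  ι := PUnit
  l _ := S.one

/-- The tensor product of morphisms. -/
def tensorMor {X₁ Y₁ X₂ Y₂ : S.Obj} (f : X₁ ⟶ Y₁) (g : X₂ ⟶ Y₂) :
    tensor X₁ X₂ ⟶ tensor Y₁ Y₂ :=
  ofMat (fun p q => if (chan p) = (chan q) then mat f (fst p) (fst q) * mat g (snd p) (snd q) else 0)
    fun _ _ h => if_neg h

/-- The associator has as its entries the `F`-symbols. -/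
def assocHom (X Y Z : S.Obj) : tensor (tensor X Y) Z ⟶ tensor X (tensor Y Z) :=
  ofMat (fun p q =>
    if (fst (fst p)) = (fst q) ∧ (snd (fst p)) = (fst (snd q)) ∧ (snd p) = (snd (snd q)) ∧
        (chan p) = (chan q) then
      S.F (X.l (fst (fst p))) (Y.l (snd (fst p))) (Z.l (snd p)) (chan p) (chan (fst p)) (chan (snd q))
    else 0)
    fun _ _ h => if_neg fun h' => h h'.2.2.2

/-- The left unitor. -/
def leftUnitorHom (X : S.Obj) : tensor (unit S) X ⟶ X :=
  ofMat (fun p i => if (snd p) = i then 1 else 0) fun p i h => if_neg fun h' => h <| by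
    have := (mem p)
    simp only [unit, S.N_one_left, Finset.mem_singleton] at this
    exact this.trans (h' ▸ rfl)

/-- The right unitor. -/
def rightUnitorHom (X : S.Obj) : tensor X (unit S) ⟶ X :=
  ofMat (fun p i => if (fst p) = i then 1 else 0) fun p i h => if_neg fun h' => h <| by
    have := (mem p)
    simp only [unit, S.N_one_right, Finset.mem_singleton] at this
    exact this.trans (h' ▸ rfl)

/-- The adjoint of a morphism is given by the conjugate transpose of its matrix. -/
def adj {X Y : S.Obj} (f : X ⟶ Y) : Y ⟶ X :=
  ofMat (mat f).conjTranspose fun i j h => by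
    rw [Matrix.conjTranspose_apply, mat_zero' f (Ne.symm h), star_zero]

theorem mat_adj {X Y : S.Obj} (f : X ⟶ Y) (i : Y.ι) (j : X.ι) :
    mat (adj f) i j = conj (mat f j i) := rfl

theorem mat_tensorMor {X₁ Y₁ X₂ Y₂ : S.Obj} (f : X₁ ⟶ Y₁) (g : X₂ ⟶ Y₂)
    (p : (tensor X₁ X₂).ι) (q : (tensor Y₁ Y₂).ι) : mat (tensorMor f g) p q =
    if (chan p) = (chan q) then mat f (fst p) (fst q) * mat g (snd p) (snd q) else 0 := rfl

theorem sum_tensor {X Y : S.Obj} (G : X.ι → Y.ι → L → ℂ)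
    (hG : ∀ i j c, c ∉ S.N (X.l i) (Y.l j) → G i j c = 0) :
    ∑ p : (tensor X Y).ι, G (fst p) (snd p) (chan p) = ∑ i, ∑ j, ∑ c, G i j c := by
  have h1 : ∑ p : {p : X.ι × Y.ι × L // p.2.2 ∈ S.N (X.l p.1) (Y.l p.2.1)},
      G p.1.1 p.1.2.1 p.1.2.2 =
      ∑ p ∈ Finset.univ.filter fun p : X.ι × Y.ι × L => p.2.2 ∈ S.N (X.l p.1) (Y.l p.2.1),
        G p.1 p.2.1 p.2.2 :=
    (Finset.sum_subtype _ (by simp) (fun p : X.ι × Y.ι × L => G p.1 p.2.1 p.2.2)).symm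
  refine h1.trans ?_
  rw [Finset.sum_filter_of_ne fun p _ hp => by by_contra h; exact hp (hG _ _ _ h)]
  simp only [Fintype.sum_prod_type]

theorem sum_tensorMor {X₁ Y₁ X₂ Y₂ : S.Obj} (f : X₁ ⟶ Y₁) (g : X₂ ⟶ Y₂)
    (p : (tensor X₁ X₂).ι) (G : Y₁.ι → Y₂.ι → L → ℂ) :
    ∑ q : (tensor Y₁ Y₂).ι, mat (tensorMor f g) p q * G (fst q) (snd q) (chan q) =
      ∑ i, ∑ j, mat f (fst p) i * mat g (snd p) j * G i j (chan p) := by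
  refine (sum_tensor (fun i j c =>
    (if (chan p) = c then mat f (fst p) i * mat g (snd p) j else 0) * G i j c) ?_).trans ?_
  · intro i j c hc
    split_ifs with h
    · by_cases h1 : X₁.l (fst p) = Y₁.l i
      · by_cases h2 : X₂.l (snd p) = Y₂.l j
        · exact absurd (h ▸ h1 ▸ h2 ▸ (mem p)) hc
        · simp [mat_zero' g h2]
      · simp [mat_zero' f h1]
    · simp
  · simp

theorem sum_assocHom {X Y Z : S.Obj} (p : (tensor (tensor X Y) Z).ι)
    (G : X.ι → Y.ι → Z.ι → L → L → ℂ) :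
    ∑ q : (tensor X (tensor Y Z)).ι, mat (assocHom X Y Z) p q *
        G (fst q) (fst (snd q)) (snd (snd q)) (chan (snd q)) (chan q) =
      ∑ f, S.F (X.l (fst (fst p))) (Y.l (snd (fst p))) (Z.l (snd p)) (chan p) (chan (fst p)) f *
        G (fst (fst p)) (snd (fst p)) (snd p) f (chan p) := by
  refine (sum_tensor (X := X) (Y := tensor Y Z) (fun i r w =>
    (if (fst (fst p)) = i ∧ (snd (fst p)) = (fst r) ∧ (snd p) = (snd r) ∧ (chan p) = w then
      S.F (X.l (fst (fst p))) (Y.l (snd (fst p))) (Z.l (snd p)) (chan p) (chan (fst p)) (chan r)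
    else 0) * G i (fst r) (snd r) (chan r) w) ?_).trans ?_
  · intro i r w hw
    split_ifs with h
    · obtain ⟨rfl, h1, h2, rfl⟩ := h
      rw [S.F_eq_zero, zero_mul]
      exact fun h => hw h.2.2
    · simp
  · simp only [ite_and, ite_mul, zero_mul]
    have hsum : ∀ i : X.ι, (∑ r : (tensor Y Z).ι, ∑ w : L, if (fst (fst p)) = i then
        if (snd (fst p)) = (fst r) then if (snd p) = (snd r) then if (chan p) = w then
          S.F (X.l (fst (fst p))) (Y.l (snd (fst p))) (Z.l (snd p)) (chan p) (chan (fst p)) (chan r) *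
            G i (fst r) (snd r) (chan r) w else 0 else 0 else 0 else 0) =
        if (fst (fst p)) = i then ∑ r : (tensor Y Z).ι,
          if (snd (fst p)) = (fst r) then if (snd p) = (snd r) then
          S.F (X.l (fst (fst p))) (Y.l (snd (fst p))) (Z.l (snd p)) (chan p) (chan (fst p)) (chan r) *
            G i (fst r) (snd r) (chan r) (chan p) else 0 else 0 else 0 := by
      intro i
      split_ifs with h
      · refine Finset.sum_congr rfl fun r _ => ?_
        split_ifs <;> simp
      · simp
    rw [Finset.sum_congr rfl fun i _ => hsum i]
    simp only [Finset.sum_ite_eq, Finset.mem_univ, if_true]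
    refine (sum_tensor (X := Y) (Y := Z) (fun j k f =>
      if (snd (fst p)) = j then if (snd p) = k then
          S.F (X.l (fst (fst p))) (Y.l (snd (fst p))) (Z.l (snd p)) (chan p) (chan (fst p)) f *
            G (fst (fst p)) j k f (chan p) else 0 else 0) ?_).trans ?_
    · intro j k f hf
      split_ifs with h1 h2
      · rw [S.F_eq_zero, zero_mul]
        subst h1 h2
        exact fun h => hf h.2.1
      · rfl
      · rfl
    · rw [Finset.sum_eq_single (snd (fst p)) (fun b _ hb => Finset.sum_eq_zero fun _ _ =>
          Finset.sum_eq_zero fun _ _ => if_neg (Ne.symm hb)) (by simp),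
        Finset.sum_eq_single (snd p) (fun b _ hb => Finset.sum_eq_zero fun _ _ => by
          simp [Ne.symm hb]) (by simp)]
      simp

theorem sum_assocHom' {X Y Z : S.Obj} (q : (tensor X (tensor Y Z)).ι)
    (G : X.ι → Y.ι → Z.ι → L → L → ℂ) :
    ∑ p : (tensor (tensor X Y) Z).ι, conj (mat (assocHom X Y Z) p q) *
        G (fst (fst p)) (snd (fst p)) (snd p) (chan (fst p)) (chan p) =
      ∑ e, conj (S.F (X.l (fst q)) (Y.l (fst (snd q))) (Z.l (snd (snd q))) (chan q) e
          (chan (snd q))) *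
        G (fst q) (fst (snd q)) (snd (snd q)) e (chan q) := by
  refine (sum_tensor (X := tensor X Y) (Y := Z) (fun r k w =>
    conj (if (fst r) = (fst q) ∧ (snd r) = (fst (snd q)) ∧ k = (snd (snd q)) ∧ w = (chan q) then
      S.F (X.l (fst r)) (Y.l (snd r)) (Z.l k) w (chan r) (chan (snd q))
    else 0) * G (fst r) (snd r) k (chan r) w) ?_).trans ?_
  · intro r k w hw
    split_ifs with h
    · rw [S.F_eq_zero, map_zero, zero_mul]
      exact fun h => hw h.1.2
    · simp
  · have hsum : ∀ r : (tensor X Y).ι, (∑ k : Z.ι, ∑ w : L,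
        conj (if (fst r) = (fst q) ∧ (snd r) = (fst (snd q)) ∧ k = (snd (snd q)) ∧ w = (chan q) then
      S.F (X.l (fst r)) (Y.l (snd r)) (Z.l k) w (chan r) (chan (snd q))
    else 0) * G (fst r) (snd r) k (chan r) w) =
        if (fst r) = (fst q) then if (snd r) = (fst (snd q)) then
          conj (S.F (X.l (fst r)) (Y.l (snd r)) (Z.l (snd (snd q))) (chan q) (chan r) (chan (snd q))) *
            G (fst r) (snd r) (snd (snd q)) (chan r) (chan q) else 0 else 0 := by
      intro r
      rw [Finset.sum_eq_single (snd (snd q)) (fun b _ hb => Finset.sum_eq_zero fun _ _ => by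
          simp [hb]) (by simp),
        Finset.sum_eq_single (chan q) (fun b _ hb => by simp [hb]) (by simp)]
      simp only [and_true, ite_and]
      split_ifs <;> simp
    rw [Finset.sum_congr rfl fun i _ => hsum i]
    refine (sum_tensor (X := X) (Y := Y) (fun i j e =>
      if i = (fst q) then if j = (fst (snd q)) then
          conj (S.F (X.l i) (Y.l j) (Z.l (snd (snd q))) (chan q) e (chan (snd q))) *
            G i j (snd (snd q)) e (chan q) else 0 else 0) ?_).trans ?_
    · intro i j e he
      split_ifs with h1 h2
      · rw [S.F_eq_zero, map_zero, zero_mul]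
        exact fun h => he h.1.1
      · rfl
      · rfl
    · rw [Finset.sum_eq_single (fst q) (fun b _ hb => Finset.sum_eq_zero fun _ _ =>
          Finset.sum_eq_zero fun _ _ => if_neg hb) (by simp),
        Finset.sum_eq_single (fst (snd q)) (fun b _ hb => Finset.sum_eq_zero fun _ _ => by
          simp [hb]) (by simp)]
      simp

theorem tensorMor_id (X Y : S.Obj) : tensorMor (𝟙 X) (𝟙 Y) = 𝟙 (tensor X Y) := by
  refine hom_ext' fun p q => ?_
  simp only [mat_tensorMor, mat_id, Matrix.one_apply, tensor_ext_iff]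
  split_ifs <;> simp_all

theorem tensorMor_comp {X₁ Y₁ Z₁ X₂ Y₂ Z₂ : S.Obj} (f₁ : X₁ ⟶ Y₁) (f₂ : X₂ ⟶ Y₂)
    (g₁ : Y₁ ⟶ Z₁) (g₂ : Y₂ ⟶ Z₂) :
    tensorMor f₁ f₂ ≫ tensorMor g₁ g₂ = tensorMor (f₁ ≫ g₁) (f₂ ≫ g₂) := by
  refine hom_ext' fun p q => ?_
  rw [mat_comp, Matrix.mul_apply]
  refine (sum_tensorMor f₁ f₂ p fun i j c =>
    if c = (chan q) then mat g₁ i (fst q) * mat g₂ j (snd q) else 0).trans ?_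
  rw [mat_tensorMor]
  split_ifs with h
  · rw [mat_comp, mat_comp, Matrix.mul_apply, Matrix.mul_apply, Finset.sum_mul_sum]
    refine Finset.sum_congr rfl fun i _ => Finset.sum_congr rfl fun j _ => ?_
    ring
  · simp

theorem mat_assocHom {X Y Z : S.Obj} (p : (tensor (tensor X Y) Z).ι)
    (q : (tensor X (tensor Y Z)).ι) : mat (assocHom X Y Z) p q =
    if (fst (fst p)) = (fst q) ∧ (snd (fst p)) = (fst (snd q)) ∧ (snd p) = (snd (snd q)) ∧
        (chan p) = (chan q) then
      S.F (X.l (fst (fst p))) (Y.l (snd (fst p))) (Z.l (snd p)) (chan p) (chan (fst p)) (chan (snd q))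
    else 0 := rfl

theorem assocHom_adj (X Y Z : S.Obj) : assocHom X Y Z ≫ adj (assocHom X Y Z) = 𝟙 _ := by
  refine hom_ext' fun p p' => ?_
  rw [mat_comp, Matrix.mul_apply]
  refine (sum_assocHom p fun i j k f w => conj (if (fst (fst p')) = i ∧ (snd (fst p')) = j ∧
    (snd p') = k ∧ (chan p') = w then
      S.F (X.l (fst (fst p'))) (Y.l (snd (fst p'))) (Z.l (snd p')) (chan p') (chan (fst p')) f
    else 0)).trans ?_
  rw [mat_id, Matrix.one_apply]
  simp only [tensor_ext_iff]
  by_cases h : (fst (fst p')) = (fst (fst p)) ∧ (snd (fst p')) = (snd (fst p)) ∧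
    (snd p') = (snd p) ∧ (chan p') = (chan p)
  · simp only [h, and_self, if_true]
    rw [S.F_mul_star _ _ _ _ _ _ (mem (fst p)) (mem p)]
    simp
  · simp only [h, if_false, map_zero, mul_zero, Finset.sum_const_zero]
    rw [if_neg]
    rintro ⟨⟨h1, h2, -⟩, h3, h4⟩
    exact h ⟨h1.symm, h2.symm, h3.symm, h4.symm⟩

theorem adj_assocHom (X Y Z : S.Obj) : adj (assocHom X Y Z) ≫ assocHom X Y Z = 𝟙 _ := by
  refine hom_ext' fun q q' => ?_
  rw [mat_comp, Matrix.mul_apply]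
  refine (sum_assocHom' q fun i j k e w => if i = (fst q') ∧ j = (fst (snd q')) ∧
    k = (snd (snd q')) ∧ w = (chan q') then
      S.F (X.l i) (Y.l j) (Z.l k) w e (chan (snd q')) else 0).trans ?_
  rw [mat_id, Matrix.one_apply]
  simp only [tensor_ext_iff]
  by_cases h : (fst q) = (fst q') ∧ (fst (snd q)) = (fst (snd q')) ∧
    (snd (snd q)) = (snd (snd q')) ∧ (chan q) = (chan q')
  · simp only [h, and_self, if_true]
    have h1 := (mem (snd q))
    have h2 := (mem q)
    simp only [h] at h1 h2
    rw [S.star_F_mul _ _ _ _ _ _ h1 h2]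
    simp
  · simp only [h, if_false, mul_zero, Finset.sum_const_zero]
    rw [if_neg]
    rintro ⟨h1, ⟨h2, h3, -⟩, h4⟩
    exact h ⟨h1, h2, h3, h4⟩

theorem mat_leftUnitorHom (X : S.Obj) (p : (tensor (unit S) X).ι) (i : X.ι) :
    mat (leftUnitorHom X) p i = if (snd p) = i then 1 else 0 := rfl

theorem mat_rightUnitorHom (X : S.Obj) (p : (tensor X (unit S)).ι) (i : X.ι) :
    mat (rightUnitorHom X) p i = if (fst p) = i then 1 else 0 := rfl

theorem leftUnitor_label {X : S.Obj} (p : (tensor (unit S) X).ι) : (chan p) = X.l (snd p) := by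
  have := (mem p)
  simpa only [unit, S.N_one_left, Finset.mem_singleton] using this

theorem rightUnitor_label {X : S.Obj} (p : (tensor X (unit S)).ι) : (chan p) = X.l (fst p) := by
  have := (mem p)
  simpa only [unit, S.N_one_right, Finset.mem_singleton] using this

theorem leftUnitorHom_adj (X : S.Obj) : leftUnitorHom X ≫ adj (leftUnitorHom X) = 𝟙 _ := by
  refine hom_ext' fun p q => ?_
  rw [mat_comp, Matrix.mul_apply, mat_id, Matrix.one_apply]
  simp only [mat_adj, mat_leftUnitorHom, tensor_ext_iff, leftUnitor_label]
  by_cases h : (snd p) = (snd q)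
  · simp [h]; rfl
  · simp [h]

theorem adj_leftUnitorHom (X : S.Obj) : adj (leftUnitorHom X) ≫ leftUnitorHom X = 𝟙 _ := by
  refine hom_ext' fun i j => ?_
  rw [mat_comp, Matrix.mul_apply, mat_id, Matrix.one_apply]
  simp only [mat_adj, mat_leftUnitorHom]
  rw [Finset.sum_eq_single (index (X := unit S) (Y := X) PUnit.unit i (X.l i)
    (by simp [unit, S.N_one_left]))]
  · change conj (if i = i then 1 else 0) * (if i = j then 1 else 0) = _
    simp
  · intro p _ hp
    have : (snd p) ≠ i := fun h => hp (tensor_ext_iff.2 ⟨rfl, h, h ▸ leftUnitor_label p⟩)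
    simp [this]
  · simp

theorem rightUnitorHom_adj (X : S.Obj) : rightUnitorHom X ≫ adj (rightUnitorHom X) = 𝟙 _ := by
  refine hom_ext' fun p q => ?_
  rw [mat_comp, Matrix.mul_apply, mat_id, Matrix.one_apply]
  simp only [mat_adj, mat_rightUnitorHom, tensor_ext_iff, rightUnitor_label]
  by_cases h : (fst p) = (fst q)
  · simp [h]; rfl
  · simp [h]

theorem adj_rightUnitorHom (X : S.Obj) : adj (rightUnitorHom X) ≫ rightUnitorHom X = 𝟙 _ := by
  refine hom_ext' fun i j => ?_
  rw [mat_comp, Matrix.mul_apply, mat_id, Matrix.one_apply]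
  simp only [mat_adj, mat_rightUnitorHom]
  rw [Finset.sum_eq_single (index (X := X) (Y := unit S) i PUnit.unit (X.l i)
    (by simp [unit, S.N_one_right]))]
  · change conj (if i = i then 1 else 0) * (if i = j then 1 else 0) = _
    simp
  · intro p _ hp
    have : (fst p) ≠ i := fun h => hp (tensor_ext_iff.2 ⟨h, rfl, h ▸ rightUnitor_label p⟩)
    simp [this]
  · simp

theorem assocHom_naturality {X₁ X₂ X₃ Y₁ Y₂ Y₃ : S.Obj} (f : X₁ ⟶ Y₁) (g : X₂ ⟶ Y₂)
    (h : X₃ ⟶ Y₃) : tensorMor (tensorMor f g) h ≫ assocHom Y₁ Y₂ Y₃ =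
      assocHom X₁ X₂ X₃ ≫ tensorMor f (tensorMor g h) := by
  refine hom_ext' fun p r => ?_
  rw [mat_comp, Matrix.mul_apply, mat_comp, Matrix.mul_apply]
  refine (sum_tensorMor (tensorMor f g) h p fun a k w => if (fst a) = (fst r) ∧
    (snd a) = (fst (snd r)) ∧ k = (snd (snd r)) ∧ w = (chan r) then
      S.F (Y₁.l (fst a)) (Y₂.l (snd a)) (Y₃.l k) w (chan a) (chan (snd r)) else 0).trans ?_
  simp only [mul_assoc, ← Finset.mul_sum]
  refine (sum_tensorMor f g (fst p) fun i j e => ∑ k, mat h (snd p) k * if i = (fst r) ∧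
    j = (fst (snd r)) ∧ k = (snd (snd r)) ∧ (chan p) = (chan r) then
      S.F (Y₁.l i) (Y₂.l j) (Y₃.l k) (chan p) e (chan (snd r)) else 0).trans ?_
  refine Eq.trans ?_ (sum_assocHom p fun i j k f' w => if w = (chan r) then
    mat f i (fst r) * (if f' = (chan (snd r)) then mat g j (fst (snd r)) * mat h k (snd (snd r))
      else 0) else 0).symm
  rw [Finset.sum_eq_single (fst r) (fun b _ hb => Finset.sum_eq_zero fun _ _ => by simp [hb])
      (by simp),
    Finset.sum_eq_single (fst (snd r)) (fun b _ hb => by simp [hb]) (by simp),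
    Finset.sum_eq_single (snd (snd r)) (fun b _ hb => by simp [hb]) (by simp)]
  by_cases hw : (chan p) = (chan r)
  · simp only [hw, and_self, if_true, mul_ite, mul_zero, Finset.sum_ite_eq',
      Finset.mem_univ]
    by_cases h1 : X₁.l (fst (fst p)) = Y₁.l (fst r)
    · by_cases h2 : X₂.l (snd (fst p)) = Y₂.l (fst (snd r))
      · by_cases h3 : X₃.l (snd p) = Y₃.l (snd (snd r))
        · rw [h1, h2, h3]; ring
        · simp [mat_zero' h h3]
      · simp [mat_zero' g h2]
    · simp [mat_zero' f h1]
  · simp [hw]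

theorem leftUnitorHom_naturality {X Y : S.Obj} (f : X ⟶ Y) :
    tensorMor (𝟙 (unit S)) f ≫ leftUnitorHom Y = leftUnitorHom X ≫ f := by
  refine hom_ext' fun p y => ?_
  rw [mat_comp, Matrix.mul_apply, mat_comp, Matrix.mul_apply]
  refine (sum_tensorMor (𝟙 (unit S)) f p fun _ j _ => if j = y then 1 else 0).trans ?_
  simp [mat_leftUnitorHom, mat_id, Matrix.one_apply]

theorem rightUnitorHom_naturality {X Y : S.Obj} (f : X ⟶ Y) :
    tensorMor f (𝟙 (unit S)) ≫ rightUnitorHom Y = rightUnitorHom X ≫ f := by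
  refine hom_ext' fun p y => ?_
  rw [mat_comp, Matrix.mul_apply, mat_comp, Matrix.mul_apply]
  refine (sum_tensorMor f (𝟙 (unit S)) p fun i _ _ => if i = y then 1 else 0).trans ?_
  simp [mat_rightUnitorHom, mat_id, Matrix.one_apply]

theorem pentagonHom (X Y Z T : S.Obj) :
    tensorMor (assocHom X Y Z) (𝟙 T) ≫ assocHom X (tensor Y Z) T ≫
        tensorMor (𝟙 X) (assocHom Y Z T) =
      assocHom (tensor X Y) Z T ≫ assocHom X Y (tensor Z T) := by
  refine hom_ext' fun p r => ?_
  have key : ∀ q, mat (assocHom X (tensor Y Z) T ≫ tensorMor (𝟙 X) (assocHom Y Z T)) q r =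
      if (fst (fst q)) = (fst r) ∧ (fst (snd (fst q))) = (fst (snd r)) ∧
        (snd (snd (fst q))) = (fst (snd (snd r))) ∧
        (snd q) = (snd (snd (snd r))) ∧ (chan q) = (chan r) then
      S.F (X.l (fst (fst q))) (chan (snd (fst q))) (T.l (snd q)) (chan q) (chan (fst q)) (chan (snd r)) *
      S.F (Y.l (fst (snd (fst q)))) (Z.l (snd (snd (fst q)))) (T.l (snd q)) (chan (snd r))
        (chan (snd (fst q))) (chan (snd (snd r))) else 0 := by
    intro q
    rw [mat_comp, Matrix.mul_apply]
    refine (sum_assocHom q fun i j t f w => if w = (chan r) then (if i = (fst r) then 1 else 0) *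
      (if (fst j) = (fst (snd r)) ∧ (snd j) = (fst (snd (snd r))) ∧ t = (snd (snd (snd r))) ∧
        f = (chan (snd r)) then S.F (Y.l (fst j)) (Z.l (snd j)) (T.l t) f (chan j)
          (chan (snd (snd r))) else 0) else 0).trans ?_
    rw [Finset.sum_eq_single (chan (snd r)) (fun b _ hb => by simp [hb]) (by simp)]
    simp only [ite_and]
    split_ifs <;> simp_all [tensor_l]
  rw [mat_comp, Matrix.mul_apply, Finset.sum_congr rfl fun q _ => by rw [key q]]
  refine (sum_tensorMor (assocHom X Y Z) (𝟙 T) p fun a t w =>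
      if (fst a) = (fst r) ∧ (fst (snd a)) = (fst (snd r)) ∧
        (snd (snd a)) = (fst (snd (snd r))) ∧ t = (snd (snd (snd r))) ∧ w = (chan r) then
      S.F (X.l (fst a)) (chan (snd a)) (T.l t) w (chan a) (chan (snd r)) *
      S.F (Y.l (fst (snd a))) (Z.l (snd (snd a))) (T.l t) (chan (snd r))
        (chan (snd a)) (chan (snd (snd r))) else 0).trans ?_
  rw [Finset.sum_congr rfl fun a _ => Finset.sum_eq_single (snd p) (fun b _ hb => by
    rw [mat_id, Matrix.one_apply_ne (Ne.symm hb), mul_zero, zero_mul]) (by simp)]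
  simp only [mat_id, Matrix.one_apply_eq, mul_one]
  refine (sum_assocHom (fst p) fun i j k g f =>
      if i = (fst r) ∧ j = (fst (snd r)) ∧
        k = (fst (snd (snd r))) ∧ (snd p) = (snd (snd (snd r))) ∧ (chan p) = (chan r) then
      S.F (X.l i) g (T.l (snd p)) (chan p) f (chan (snd r)) *
      S.F (Y.l j) (Z.l k) (T.l (snd p)) (chan (snd r))
        g (chan (snd (snd r))) else 0).trans ?_
  rw [mat_comp, Matrix.mul_apply]
  have key2 : ∀ q, mat (assocHom X Y (tensor Z T)) q r =
      if (fst (fst q)) = (fst r) ∧ (snd (fst q)) = (fst (snd r)) ∧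
        (fst (snd q)) = (fst (snd (snd r))) ∧ (snd (snd q)) = (snd (snd (snd r))) ∧
        (chan (snd q)) = (chan (snd (snd r))) ∧ (chan q) = (chan r) then
      S.F (X.l (fst (fst q))) (Y.l (snd (fst q))) (chan (snd q)) (chan q) (chan (fst q)) (chan (snd r))
      else 0 := by
    intro q
    rw [mat_assocHom]
    simp only [tensor_ext_iff (X := Z) (Y := T), and_assoc]
    rfl
  simp only [key2]
  refine Eq.trans ?_ (sum_assocHom p fun a k t h w =>
    if (fst a) = (fst r) ∧ (snd a) = (fst (snd r)) ∧
        k = (fst (snd (snd r))) ∧ t = (snd (snd (snd r))) ∧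
        h = (chan (snd (snd r))) ∧ w = (chan r) then
      S.F (X.l (fst a)) (Y.l (snd a)) h w (chan a) (chan (snd r)) else 0).symm
  refine Eq.trans ?_ (Finset.sum_eq_single (chan (snd (snd r))) (fun b _ hb => by simp [hb])
    (by simp)).symm
  by_cases h : (fst (fst (fst p))) = (fst r) ∧ (snd (fst (fst p))) = (fst (snd r)) ∧
        (snd (fst p)) = (fst (snd (snd r))) ∧ (snd p) = (snd (snd (snd r))) ∧ (chan p) = (chan r)
  · simp only [h, and_self, if_true, ← mul_assoc]
    exact S.pentagon _ _ _ _ _ _ _ _ _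
  · have h' : ¬ ((fst (fst (fst p))) = (fst r) ∧ (snd (fst (fst p))) = (fst (snd r)) ∧
        (snd (fst p)) = (fst (snd (snd r))) ∧ (snd p) = (snd (snd (snd r))) ∧
        (chan (snd (snd r))) = (chan (snd (snd r))) ∧ (chan p) = (chan r)) := by
      simpa using h
    rw [if_neg h', mul_zero]
    refine Finset.sum_eq_zero fun g _ => ?_
    rw [if_neg h, mul_zero]

theorem triangleHom (X Y : S.Obj) :
    assocHom X (unit S) Y ≫ tensorMor (𝟙 X) (leftUnitorHom Y) =
      tensorMor (rightUnitorHom X) (𝟙 Y) := by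
  refine hom_ext' fun p r => ?_
  rw [mat_comp, Matrix.mul_apply]
  refine (sum_assocHom p fun i _ j _ w => if w = (chan r) then (if i = (fst r) then 1 else 0) *
    (if j = (snd r) then 1 else 0) else 0).trans ?_
  rw [← Finset.sum_mul, mat_tensorMor, mat_rightUnitorHom, mat_id, Matrix.one_apply]
  have h1 : (chan (fst p)) = X.l (fst (fst p)) := rightUnitor_label (fst p)
  have h2 := (mem p)
  change (chan p) ∈ S.N (chan (fst p)) _ at h2
  rw [h1] at h2 ⊢
  rw [Finset.sum_eq_single (Y.l (snd p))]
  · have : (unit S).l (snd (fst p)) = S.one := rfl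
    rw [this, S.F_one _ _ _ h2, one_mul]
  · intro f _ hf
    refine S.F_eq_zero _ _ _ _ _ _ fun h => hf ?_
    have := h.2.1
    simpa only [unit, S.N_one_left, Finset.mem_singleton] using this
  · simp

/-- The monoidal structure given by the fusion rules, with the `F`-symbols as associator. -/
instance : MonoidalCategoryStruct S.Obj where
  tensorObj := tensor
  tensorUnit := unit S
  tensorHom := tensorMor
  whiskerLeft X _ _ f := tensorMor (𝟙 X) f
  whiskerRight f Y := tensorMor f (𝟙 Y)
  associator X Y Z := ⟨assocHom X Y Z, adj (assocHom X Y Z), assocHom_adj X Y Z, adj_assocHom X Y Z⟩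
  leftUnitor X := ⟨leftUnitorHom X, adj (leftUnitorHom X), leftUnitorHom_adj X, adj_leftUnitorHom X⟩
  rightUnitor X :=
    ⟨rightUnitorHom X, adj (rightUnitorHom X), rightUnitorHom_adj X, adj_rightUnitorHom X⟩

instance : MonoidalCategory S.Obj := MonoidalCategory.ofTensorHom
  (id_tensorHom_id := tensorMor_id)
  (id_tensorHom := fun _ _ _ _ => rfl)
  (tensorHom_id := fun _ _ => rfl)
  (tensorHom_comp_tensorHom := tensorMor_comp)
  (associator_naturality := assocHom_naturality)
  (leftUnitor_naturality := leftUnitorHom_naturality)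
  (rightUnitor_naturality := rightUnitorHom_naturality)
  (pentagon := pentagonHom)
  (triangle := triangleHom)

end FusionSystem

namespace FusionSystem

variable {L : Type u} [Fintype L] [DecidableEq L] {S : FusionSystem L}

/-- The adjoints are the conjugate transposes. -/
instance : DaggerCategory S.Obj where
  dag := adj
  dag_id _ := Subtype.ext Matrix.conjTranspose_one
  dag_comp f g := Subtype.ext (Matrix.conjTranspose_mul f.1 g.1)
  dag_dag f := Subtype.ext (Matrix.conjTranspose_conjTranspose f.1)

theorem mat_dag {X Y : S.Obj} (f : X ⟶ Y) :
    mat (DaggerCategory.dag f) = (mat f).conjTranspose := rfl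

theorem dag_tensorMor {X₁ Y₁ X₂ Y₂ : S.Obj} (f : X₁ ⟶ Y₁) (g : X₂ ⟶ Y₂) :
    adj (tensorMor f g) = tensorMor (adj f) (adj g) := by
  refine hom_ext' fun p q => ?_
  simp only [mat_adj, mat_tensorMor, eq_comm (a := chan q)]
  split_ifs <;> simp

section
open scoped Matrix.Norms.L2Operator MatrixOrder ComplexOrder

instance : CStarCategory S.Obj where
  dag_add f g := Subtype.ext (Matrix.conjTranspose_add f.1 g.1)
  dag_smul c f := Subtype.ext (Matrix.conjTranspose_smul c f.1)
  exists_norm := by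
    refine ⟨fun f => ‖mat f‖, fun f => ⟨norm_nonneg _, norm_eq_zero.trans ?_⟩,
      fun f g => norm_add_le (mat f) (mat g), fun c f => norm_smul c (mat f),
      fun f g => Matrix.l2_opNorm_mul (mat f) (mat g), fun f => ?_⟩
    · exact ⟨fun h => Subtype.ext h, fun h => by rw [h]; rfl⟩
    · change ‖mat f * (mat f).conjTranspose‖ = ‖mat f‖ ^ 2
      rw [sq]
      have := Matrix.l2_opNorm_conjTranspose_mul_self (mat f).conjTranspose
      rwa [Matrix.conjTranspose_conjTranspose, Matrix.l2_opNorm_conjTranspose] at this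
  exists_comp_dag_eq {X Y} f := by
    let M := mat f * (mat f).conjTranspose
    have hM : (0 : Matrix X.ι X.ι ℂ) ≤ M := (Matrix.posSemidef_self_mul_conjTranspose _).nonneg
    let R := CFC.sqrt M
    have hR : R * R = M := CFC.sqrt_mul_sqrt_self M hM
    have hR' : R.conjTranspose = R := (CFC.sqrt_nonneg M).isSelfAdjoint
    have hsupp : ∀ i j, X.l i ≠ X.l j → R i j = 0 := by
      intro i j hij
      let P : Matrix X.ι X.ι ℂ := Matrix.diagonal fun k => if X.l k = X.l i then 1 else 0
      have hP : Commute P M := by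
        ext a b
        simp only [P, Matrix.diagonal_mul, Matrix.mul_diagonal]
        have : X.l a ≠ X.l b → M a b = 0 := (f ≫ adj f).2 a b
        by_cases h : X.l a = X.l b
        · rw [h, mul_comm]
        · rw [this h]; simp
      have hPR : Commute P R := (hP.symm.cfcₙ_nnreal NNReal.sqrt).symm
      have := congrFun (congrFun hPR.eq i) j
      simpa [P, Matrix.diagonal_mul, Matrix.mul_diagonal, Ne.symm hij] using this
    exact ⟨ofMat R hsupp, Subtype.ext (by
      change M = R * R.conjTranspose
      rw [hR', hR])⟩

end

theorem tensorMor_add {X₁ Y₁ X₂ Y₂ : S.Obj} (f : X₁ ⟶ Y₁) (g h : X₂ ⟶ Y₂) :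
    tensorMor f (g + h) = tensorMor f g + tensorMor f h := by
  refine hom_ext' fun p q => ?_
  simp only [mat_tensorMor, mat_add, Matrix.add_apply]
  split_ifs <;> ring

theorem add_tensorMor {X₁ Y₁ X₂ Y₂ : S.Obj} (f g : X₁ ⟶ Y₁) (h : X₂ ⟶ Y₂) :
    tensorMor (f + g) h = tensorMor f h + tensorMor g h := by
  refine hom_ext' fun p q => ?_
  simp only [mat_tensorMor, mat_add, Matrix.add_apply]
  split_ifs <;> ring

theorem tensorMor_smul {X₁ Y₁ X₂ Y₂ : S.Obj} (c : ℂ) (f : X₁ ⟶ Y₁) (g : X₂ ⟶ Y₂) :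
    tensorMor f (c • g) = c • tensorMor f g := by
  refine hom_ext' fun p q => ?_
  simp only [mat_tensorMor, mat_smul, Matrix.smul_apply, smul_eq_mul]
  split_ifs <;> ring

theorem smul_tensorMor {X₁ Y₁ X₂ Y₂ : S.Obj} (c : ℂ) (f : X₁ ⟶ Y₁) (g : X₂ ⟶ Y₂) :
    tensorMor (c • f) g = c • tensorMor f g := by
  refine hom_ext' fun p q => ?_
  simp only [mat_tensorMor, mat_smul, Matrix.smul_apply, smul_eq_mul]
  split_ifs <;> ring

instance : MonoidalPreadditive S.Obj where
  whiskerLeft_zero {X Y Z} := by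
    have h := tensorMor_add (𝟙 X) (0 : Y ⟶ Z) 0
    rw [add_zero] at h
    exact left_eq_add.1 h
  zero_whiskerRight {X Y Z} := by
    have h := add_tensorMor (0 : Y ⟶ Z) 0 (𝟙 X)
    rw [add_zero] at h
    exact left_eq_add.1 h
  whiskerLeft_add f g := tensorMor_add _ f g
  add_whiskerRight f g := add_tensorMor f g _

instance : MonoidalLinear ℂ S.Obj where
  whiskerLeft_smul _ _ _ c f := tensorMor_smul c _ f
  smul_whiskerRight c _ _ f _ := smul_tensorMor c f _

/-- The simple object with a given label. -/
def simpleObj (S : FusionSystem L) (c : L) : S.Obj where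
  ι := PUnit
  l _ := c

theorem isSimpleObj_simpleObj (c : L) : IsSimpleObj (simpleObj S c) := by
  refine ⟨fun h => ?_, fun f => ⟨mat f PUnit.unit PUnit.unit, ?_⟩⟩
  · have h2 : mat (𝟙 (simpleObj S c)) PUnit.unit PUnit.unit = 0 := by rw [h]; rfl
    rw [mat_id] at h2
    exact one_ne_zero ((Matrix.one_apply_eq _).symm.trans h2)
  · refine hom_ext' fun i j => ?_
    rw [mat_smul, mat_id]
    cases i; cases j
    change _ = mat f PUnit.unit PUnit.unit * 1
    rw [mul_one]

theorem hasBiproduct_of_index {n : ℕ} (f : Fin n → S.Obj) (X : S.Obj)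
    (e : X.ι ≃ Σ k, (f k).ι) (he : ∀ i, X.l i = (f (e i).1).l (e i).2) :
    ∃ b : Limits.Bicone f, b.pt = X ∧ ∑ k, b.π k ≫ b.ι k = 𝟙 b.pt := by
  let inc : ∀ k, f k ⟶ X := fun k =>
    ofMat (fun j i => if e i = ⟨k, j⟩ then 1 else 0) fun j i h => if_neg fun h' => h <| by
      rw [he, h']
  have hmat : ∀ k j i, mat (inc k) j i = if e i = ⟨k, j⟩ then 1 else 0 := fun _ _ _ => rfl
  refine ⟨⟨X, fun k => adj (inc k), inc, ?_⟩, rfl, ?_⟩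
  · intro k k'
    split_ifs with h
    · subst h
      refine hom_ext' fun j j' => ?_
      rw [mat_comp, Matrix.mul_apply, eqToHom_refl, mat_id, Matrix.one_apply,
        Finset.sum_eq_single (e.symm ⟨k, j⟩)]
      · simp [mat_adj, hmat]
      · intro i _ hi
        have : e i ≠ ⟨k, j⟩ := fun h => hi (by simp [← h])
        simp [hmat, this]
      · simp
    · refine hom_ext' fun j j' => ?_
      rw [mat_comp, Matrix.mul_apply, mat_zero]
      refine Finset.sum_eq_zero fun i _ => ?_
      rw [mat_adj, hmat, hmat]
      split_ifs with h1 h2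
      · rw [h1] at h2
        exact absurd (congrArg Sigma.fst h2) h
      all_goals simp
  · refine hom_ext' fun i i' => ?_
    have h1 : ∀ (s : Finset (Fin n)) (g : Fin n → (X ⟶ X)),
        mat (∑ k ∈ s, g k) i i' = ∑ k ∈ s, mat (g k) i i' := by
      intro s g
      induction s using Finset.induction_on with
      | empty => rfl
      | insert a s ha ih => rw [Finset.sum_insert ha, Finset.sum_insert ha, mat_add,
          Matrix.add_apply, ih]
    refine (h1 _ _).trans ?_
    simp only [mat_comp, Matrix.mul_apply, mat_adj, hmat]
    rw [mat_id, Matrix.one_apply, ← Fintype.sum_sigma'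
      (f := fun k j => conj (if e i = ⟨k, j⟩ then (1 : ℂ) else 0) *
        if e i' = ⟨k, j⟩ then 1 else 0)]
    rw [Finset.sum_eq_single (e i)]
    · simp [eq_comm]
    · intro b _ hb
      simp [Ne.symm hb]
    · simp

instance : Limits.HasFiniteBiproducts S.Obj where
  out n := ⟨fun f => by
    obtain ⟨b, -, hb⟩ := hasBiproduct_of_index f
      ({ ι := Σ k, (f k).ι, l := fun p => (f p.1).l p.2 } : S.Obj) (Equiv.refl _) fun _ => rfl
    exact Limits.hasBiproduct_of_total b hb⟩

theorem semisimple_aux (X : S.Obj) : ∃ (n : ℕ) (c : Fin n → Fin (Fintype.card L)),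
    Nonempty (X ≅ Limits.biproduct fun k => simpleObj S ((Fintype.equivFin L).symm (c k))) := by
  let e := Fintype.equivFin X.ι
  let c : Fin (Fintype.card X.ι) → Fin (Fintype.card L) :=
    fun k => Fintype.equivFin L (X.l (e.symm k))
  obtain ⟨b, hX, hb⟩ := hasBiproduct_of_index
    (fun k => simpleObj S ((Fintype.equivFin L).symm (c k))) X
    (e.trans (Equiv.sigmaPUnit _).symm) (fun i => by
      simp only [simpleObj, c, Equiv.symm_apply_apply]
      exact congrArg X.l (e.symm_apply_apply i).symm)
  exact ⟨_, c, ⟨(eqToIso hX.symm).trans <| Limits.biproduct.uniqueUpToIso _ (Limits.isBilimitOfTotal b hb)⟩⟩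

/-- A candidate for a coevaluation. -/
def coevMor (X Y : S.Obj) (e : X.ι ≃ Y.ι) (b : X.ι → ℂ) : unit S ⟶ tensor X Y :=
  ofMat (fun _ p => if e (fst p) = snd p ∧ chan p = S.one then b (fst p) else 0)
    fun _ _ h => if_neg fun h' => h h'.2.symm

/-- A candidate for an evaluation. -/
def evMor (X Y : S.Obj) (e : X.ι ≃ Y.ι) (c : X.ι → ℂ) : tensor Y X ⟶ unit S :=
  ofMat (fun p _ => if e (snd p) = fst p ∧ chan p = S.one then c (snd p) else 0)
    fun _ _ h => if_neg fun h' => h h'.2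

theorem zigzag (X Y : S.Obj) (e : X.ι ≃ Y.ι) (b c : X.ι → ℂ)
    (h1 : ∀ i, S.one ∈ S.N (X.l i) (Y.l (e i)))
    (hF : ∀ i, b i * c i * S.F (X.l i) (Y.l (e i)) (X.l i) (X.l i) S.one S.one = 1) :
    tensorMor (coevMor X Y e b) (𝟙 X) ≫ assocHom X Y X ≫ tensorMor (𝟙 X) (evMor X Y e c) =
      leftUnitorHom X ≫ adj (rightUnitorHom X) := by
  refine hom_ext' fun p r => ?_
  have key : ∀ q, mat (assocHom X Y X ≫ tensorMor (𝟙 X) (evMor X Y e c)) q r =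
      if chan q = chan r then if fst (fst q) = fst r then if e (snd q) = snd (fst q) then
        S.F (X.l (fst (fst q))) (Y.l (snd (fst q))) (X.l (snd q)) (chan q) (chan (fst q)) S.one *
          c (snd q) else 0 else 0 else 0 := by
    intro q
    rw [mat_comp, Matrix.mul_apply]
    refine (sum_assocHom q fun i j k f w => if w = chan r then (if i = fst r then 1 else 0) *
      (if e k = j ∧ f = S.one then c k else 0) else 0).trans ?_
    rw [Finset.sum_eq_single S.one (fun b _ hb => by simp [hb]) (by simp)]
    simp only [ite_and]
    split_ifs <;> simp_all
  rw [mat_comp, Matrix.mul_apply]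
  simp only [key]
  refine (sum_tensorMor (coevMor X Y e b) (𝟙 X) p fun a k w =>
    if w = chan r then if fst a = fst r then if e k = snd a then
        S.F (X.l (fst a)) (Y.l (snd a)) (X.l k) w (chan a) S.one * c k
          else 0 else 0 else 0).trans ?_
  rw [Finset.sum_congr rfl fun a _ => Finset.sum_eq_single (snd p) (fun b _ hb => by
    rw [mat_id, Matrix.one_apply_ne (Ne.symm hb), mul_zero, zero_mul]) (by simp)]
  simp only [mat_id, Matrix.one_apply_eq, mul_one]
  refine (sum_tensor (X := X) (Y := Y) (fun i j l => (if e i = j ∧ l = S.one then b i else 0) *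
    if chan p = chan r then if i = fst r then if e (snd p) = j then
        S.F (X.l i) (Y.l j) (X.l (snd p)) (chan p) l S.one * c (snd p)
          else 0 else 0 else 0) ?_).trans ?_
  · intro i j l hl
    rw [if_neg, zero_mul]
    rintro ⟨rfl, rfl⟩
    exact hl (h1 i)
  have hp : chan p = X.l (snd p) := leftUnitor_label p
  have hr : chan r = X.l (fst r) := rightUnitor_label r
  rw [mat_comp, Matrix.mul_apply,
    Finset.sum_eq_single (fst r) (fun i _ hi => Finset.sum_eq_zero fun _ _ =>
      Finset.sum_eq_zero fun _ _ => by simp [hi]) (by simp),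
    Finset.sum_eq_single (e (fst r)) (fun j _ hj => Finset.sum_eq_zero fun _ _ => by
      simp [Ne.symm hj]) (by simp),
    Finset.sum_eq_single S.one (fun l _ hl => by simp [hl]) (by simp)]
  simp only [mat_adj, mat_leftUnitorHom, mat_rightUnitorHom]
  by_cases h : snd p = fst r
  · have hpr : chan p = chan r := by rw [hp, hr, h]
    simp only [h, hpr, if_true, and_self, ite_mul, one_mul, zero_mul]
    rw [Finset.sum_eq_single (fst r) (fun i _ hi => by simp [Ne.symm hi]) (by simp), hr]
    simp only [if_true, map_one]
    rw [← hF (fst r)]; ring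
  · have : ∀ i, ((if snd p = i then (1 : ℂ) else 0) * conj (if fst r = i then (1 : ℂ) else 0)) =
        0 := by
      intro i
      split_ifs with h1 h2
      · exact absurd (h1.trans h2.symm) h
      all_goals simp
    simp only [this, Finset.sum_const_zero]
    simp [h]

theorem adj_comp {X Y Z : S.Obj} (f : X ⟶ Y) (g : Y ⟶ Z) : adj (f ≫ g) = adj g ≫ adj f :=
  DaggerCategory.dag_comp f g

theorem adj_adj {X Y : S.Obj} (f : X ⟶ Y) : adj (adj f) = f := DaggerCategory.dag_dag f

theorem adj_id (X : S.Obj) : adj (𝟙 X) = 𝟙 X := DaggerCategory.dag_id X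

theorem adj_coevMor (X Y : S.Obj) (e : X.ι ≃ Y.ι) (b : X.ι → ℂ) :
    adj (coevMor X Y e b) = evMor Y X e.symm (fun j => conj (b (e.symm j))) := by
  refine hom_ext' fun p q => ?_
  change conj (if e (fst p) = snd p ∧ chan p = S.one then b (fst p) else 0) =
    if e.symm (snd p) = fst p ∧ chan p = S.one then conj (b (e.symm (snd p))) else 0
  have : e (fst p) = snd p ↔ e.symm (snd p) = fst p := by
    rw [Equiv.symm_apply_eq, eq_comm]
  simp only [this]
  split_ifs with h
  · rw [h.1]
  · simp

theorem adj_evMor (X Y : S.Obj) (e : X.ι ≃ Y.ι) (c : X.ι → ℂ) :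
    adj (evMor X Y e c) = coevMor Y X e.symm (fun j => conj (c (e.symm j))) := by
  rw [← adj_adj (coevMor Y X e.symm _), adj_coevMor]
  congr 2
  funext i
  simp

theorem exactPairing (X Y : S.Obj) (e : X.ι ≃ Y.ι) (b c : X.ι → ℂ)
    (h1 : ∀ i, S.one ∈ S.N (X.l i) (Y.l (e i)))
    (h2 : ∀ i, S.one ∈ S.N (Y.l (e i)) (X.l i))
    (hF : ∀ i, b i * c i * S.F (X.l i) (Y.l (e i)) (X.l i) (X.l i) S.one S.one = 1)
    (hF' : ∀ i, conj (b i) * conj (c i) *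
      S.F (Y.l (e i)) (X.l i) (Y.l (e i)) (Y.l (e i)) S.one S.one = 1) :
    Nonempty (ExactPairing X Y) := by
  have hz := zigzag Y X e.symm (fun j => conj (c (e.symm j))) (fun j => conj (b (e.symm j)))
    (fun j => by simpa using h2 (e.symm j)) (fun j => by
      have := hF' (e.symm j)
      simp only [Equiv.apply_symm_apply] at this
      rw [← this]
      ring)
  rw [← adj_evMor, ← adj_coevMor] at hz
  have hz' := congrArg adj hz
  simp only [adj_comp, dag_tensorMor, adj_adj, adj_id, Category.assoc] at hz'
  exact ⟨{
    coevaluation' := coevMor X Y e b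
    evaluation' := evMor X Y e c
    evaluation_coevaluation' := zigzag X Y e b c h1 hF
    coevaluation_evaluation' := hz' }⟩

/-- The category of a fusion system with suitable duals is a unitary fusion category. -/
theorem unitaryFusionCategory (S : FusionSystem L) (dual : L → L) (c : L → ℂ)
    (h1 : ∀ x, S.one ∈ S.N x (dual x)) (h2 : ∀ x, S.one ∈ S.N (dual x) x)
    (hF : ∀ x, c x * S.F x (dual x) x x S.one S.one = 1)
    (hF' : ∀ x, conj (c x) * S.F (dual x) x (dual x) (dual x) S.one S.one = 1) :
    UnitaryFusionCategory S.Obj where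
  simple_unit := isSimpleObj_simpleObj S.one
  semisimple := ⟨Fintype.card L, fun k => simpleObj S ((Fintype.equivFin L).symm k),
    fun k => isSimpleObj_simpleObj _, fun i j hij f => hom_ext' fun _ _ =>
      mat_zero' f fun h => hij ((Fintype.equivFin L).symm.injective h), semisimple_aux⟩
  rigid X := by
    let Y : S.Obj := { ι := X.ι, l := fun i => dual (X.l i) }
    refine ⟨⟨Y, exactPairing X Y (Equiv.refl _) (fun _ => 1) (fun i => c (X.l i))
      (fun i => h1 _) (fun i => h2 _) (fun i => ?_) fun i => ?_⟩,
      ⟨Y, exactPairing Y X (Equiv.refl _) (fun _ => 1) (fun i => conj (c (X.l i)))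
      (fun i => h2 _) (fun i => h1 _) (fun i => ?_) fun i => ?_⟩⟩
    · simpa using hF (X.l i)
    · simpa using hF' (X.l i)
    · simpa using hF' (X.l i)
    · simpa using hF (X.l i)
  dag_tensor f g := dag_tensorMor f g
  associator_unitary X Y Z := ⟨assocHom_adj X Y Z, adj_assocHom X Y Z⟩
  leftUnitor_unitary X := ⟨leftUnitorHom_adj X, adj_leftUnitorHom X⟩
  rightUnitor_unitary X := ⟨rightUnitorHom_adj X, adj_rightUnitorHom X⟩

end FusionSystem

/-- The data of a Tambara-Yamagami category: a nondegenerate symmetric bicharacter `χ` on `A` and a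
sign `ξ`. -/
structure TYData (A : Type u) [CommGroup A] where
  χ : A →* A →* Circle
  symm : ∀ a b, χ a b = χ b a
  nondegenerate : ∀ a, (∀ b, χ a b = 1) → a = 1
  ξ : ℤˣ

namespace TYData

variable {A : Type u} [CommGroup A] [Fintype A] [DecidableEq A]

/-- The Tambara-Yamagami fusion rules on the labels `A ∪ {τ}`; `some a` stands for `a ∈ A` and
`none` for `τ`: `a ⊗ b = ab`, `a ⊗ τ = τ = τ ⊗ a`, `τ ⊗ τ = ⨁ a`. -/
def fuse : Option A → Option A → Finset (Option A)
  | some a, some b => {some (a * b)}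
  | some _, none => {none}
  | none, some _ => {none}
  | none, none => Finset.univ.image some

/-- The Tambara-Yamagami associators on admissible channels: `a ⊗ τ ⊗ b` has the associator `χ(a, b)`,
`τ ⊗ a ⊗ τ` has `⨁_b χ(a, b)`, `τ ⊗ τ ⊗ τ` has the matrix `ξ |A|^(-1/2) χ(a, b)⁻¹`, and all others
are identities. -/
def assocCoeff (d : TYData A) :
    Option A → Option A → Option A → Option A → Option A → Option A → ℂ
  | some a, none, some b, _, _, _ => (d.χ a b : ℂ)
  | none, some a, none, some b, _, _ => (d.χ a b : ℂ)
  | none, none, none, none, some a, some b =>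
      ((d.ξ : ℤ) : ℂ) / (Real.sqrt (Fintype.card A) : ℂ) * (d.χ a b : ℂ)⁻¹
  | _, _, _, _, _, _ => 1

/-- The Tambara-Yamagami `F`-symbols, extended by zero to all labels. -/
def fSymbol (d : TYData A) (x y z w e f : Option A) : ℂ :=
  if (e ∈ fuse x y ∧ w ∈ fuse e z) ∧ (f ∈ fuse y z ∧ w ∈ fuse x f) then
    d.assocCoeff x y z w e f else 0

theorem sum_char (d : TYData A) (a : A) :
    ∑ g, (d.χ a g : ℂ) = if a = 1 then (Fintype.card A : ℂ) else 0 := by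
  split_ifs with h
  · subst h; simp
  · have : ∃ b, d.χ a b ≠ 1 := by
      by_contra! hb
      exact h (d.nondegenerate a hb)
    obtain ⟨b, hb⟩ := this
    have key : (d.χ a b : ℂ) * ∑ g, (d.χ a g : ℂ) = ∑ g, (d.χ a g : ℂ) := by
      rw [Finset.mul_sum]
      refine Fintype.sum_equiv (Equiv.mulLeft b) _ _ fun g => ?_
      simp
    have h1 : ((d.χ a b : ℂ) - 1) * ∑ g, (d.χ a g : ℂ) = 0 := by
      rw [sub_mul, key]; simp
    rcases mul_eq_zero.1 h1 with h2 | h2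
    · exact absurd (Circle.ext (by simpa using sub_eq_zero.1 h2)) hb
    · exact h2

theorem coeff_sq (d : TYData A) :
    (((d.ξ : ℤ) : ℂ) / (Real.sqrt (Fintype.card A) : ℂ)) *
      (((d.ξ : ℤ) : ℂ) / (Real.sqrt (Fintype.card A) : ℂ)) * (Fintype.card A : ℂ) = 1 := by
  have h1 : ((d.ξ : ℤ) : ℂ) * ((d.ξ : ℤ) : ℂ) = 1 := by
    rcases Int.units_eq_one_or d.ξ with h | h <;> simp [h]
  have h2 : (Real.sqrt (Fintype.card A) : ℂ) * (Real.sqrt (Fintype.card A) : ℂ)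
      = (Fintype.card A : ℂ) := by
    rw [← Complex.ofReal_mul, Real.mul_self_sqrt (by positivity)]; simp
  have h3 : (Fintype.card A : ℂ) ≠ 0 := by simp
  rw [div_mul_div_comm, h1, h2]
  field_simp

theorem fSymbol_eq (d : TYData A) (x y z w e f : Option A) : d.fSymbol x y z w e f =
    if e ∈ fuse x y then if w ∈ fuse e z then if f ∈ fuse y z then if w ∈ fuse x f then
      d.assocCoeff x y z w e f else 0 else 0 else 0 else 0 := by
  simp only [fSymbol, ite_and]

set_option maxHeartbeats 0 in
theorem pentagon_fSymbol_none (d : TYData A) (y z t w e f h k : Option A) :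
    ∑ g, d.fSymbol none y z f e g * d.fSymbol none g t w f k * d.fSymbol y z t k g h =
      d.fSymbol e z t w f h * d.fSymbol none y h w e k := by
  rcases y with _ | y <;> rcases z with _ | z <;> rcases t with _ | t <;>
  rcases w with _ | w <;> rcases e with _ | e <;> rcases f with _ | f <;>
  rcases h with _ | h <;> rcases k with _ | k <;>
  simp [fSymbol_eq, fuse, assocCoeff, Fintype.sum_option]
  · have hx : ∀ x, ((d.ξ : ℤ) : ℂ) / (Real.sqrt (Fintype.card A) : ℂ) * (d.χ e x : ℂ)⁻¹ *
        (d.χ x w : ℂ) * (((d.ξ : ℤ) : ℂ) / (Real.sqrt (Fintype.card A) : ℂ) * (d.χ x h : ℂ)⁻¹) =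
        (((d.ξ : ℤ) : ℂ) / (Real.sqrt (Fintype.card A) : ℂ)) *
        (((d.ξ : ℤ) : ℂ) / (Real.sqrt (Fintype.card A) : ℂ)) * (d.χ (w * e⁻¹ * h⁻¹) x : ℂ) := by
      intro x
      rw [d.symm x w, d.symm x h]
      simp
      ring
    rw [Finset.sum_congr rfl fun x _ => hx x, ← Finset.mul_sum, d.sum_char]
    have hw : w * e⁻¹ * h⁻¹ = 1 ↔ w = e * h := by
      rw [mul_inv_eq_one, mul_inv_eq_iff_eq_mul, mul_comm]
    simp only [hw]
    split_ifs
    · exact d.coeff_sq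
    · simp
  · have hx : ∀ x, k = x * t ↔ k * t⁻¹ = x := fun x => by
      rw [mul_inv_eq_iff_eq_mul]
    simp only [hx]
    simp [d.symm e t]
    ring
  · split_ifs with h1
    · subst h1; simp; field_simp
    · rfl
  · split_ifs <;> grind [mul_assoc]
  · split_ifs with h1
    · subst h1; simp [d.symm y f]; field_simp
    · rfl
  · split_ifs with h1
    · subst h1; simp
    · rfl
  · ring
  · split_ifs <;> grind [mul_assoc]

set_option maxHeartbeats 0 in
theorem pentagon_fSymbol_some (d : TYData A) (x : A) (y z t w e f h k : Option A) :
    ∑ g, d.fSymbol (some x) y z f e g * d.fSymbol (some x) g t w f k * d.fSymbol y z t k g h =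
      d.fSymbol e z t w f h * d.fSymbol (some x) y h w e k := by
  rcases y with _ | y <;> rcases z with _ | z <;> rcases t with _ | t <;>
  rcases w with _ | w <;> rcases e with _ | e <;> rcases f with _ | f <;>
  rcases h with _ | h <;> rcases k with _ | k <;>
  simp [fSymbol_eq, fuse, assocCoeff, Fintype.sum_option]
  · have hx : ∀ g, f = x * g ↔ x⁻¹ * f = g := fun g => by
      rw [inv_mul_eq_iff_eq_mul]
    simp only [hx]
    simp
    ring
  · obtain ⟨g, rfl⟩ : ∃ g, f = x * g := ⟨x⁻¹ * f, by simp⟩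
    have hk : x * k = x * g * t ↔ k = g * t := by rw [mul_assoc, mul_right_inj]
    rw [Finset.sum_eq_single g]
    · split_ifs <;> grind [mul_assoc]
    · intro b _ hb
      have : x * g ≠ x * b := fun h => hb (mul_left_cancel h).symm
      simp [this]
    · simp
  · split_ifs with h1
    · subst h1; simp [d.symm x z]
    · rfl
  · split_ifs with h1
    · subst h1; simp
    · rfl
  · split_ifs <;> grind [mul_assoc]
  · split_ifs with h1
    · subst h1; simp
    · rfl
  · split_ifs <;> grind [mul_assoc]
  · split_ifs <;> grind [mul_assoc]

theorem pentagon_fSymbol (d : TYData A) : ∀ x y z t w e f h k : Option A,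
    ∑ g, d.fSymbol x y z f e g * d.fSymbol x g t w f k * d.fSymbol y z t k g h =
      d.fSymbol e z t w f h * d.fSymbol x y h w e k
  | none => d.pentagon_fSymbol_none
  | some x => d.pentagon_fSymbol_some x

theorem conj_χ (d : TYData A) (a b : A) : conj (d.χ a b : ℂ) = (d.χ a b : ℂ)⁻¹ := by
  rw [← Circle.coe_inv_eq_conj, Circle.coe_inv]

theorem fSymbol_mul_star (d : TYData A) : ∀ x y z w e e' : Option A,
    e ∈ fuse x y → w ∈ fuse e z →
    ∑ f, d.fSymbol x y z w e f * conj (d.fSymbol x y z w e' f) = if e = e' then 1 else 0 := by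
  intro x y z w e e' h1 h2
  rcases x with _ | x <;> rcases y with _ | y <;> rcases z with _ | z <;>
  rcases w with _ | w <;> rcases e with _ | e <;> rcases e' with _ | e' <;>
  simp [fuse] at h1 h2 <;>
  simp [fSymbol_eq, fuse, assocCoeff, Fintype.sum_option, *]
  · have hx : ∀ x, ((d.ξ : ℤ) : ℂ) / (Real.sqrt (Fintype.card A) : ℂ) * (d.χ e x : ℂ)⁻¹ *
        (((d.ξ : ℤ) : ℂ) / (Real.sqrt (Fintype.card A) : ℂ) * (conj (d.χ e' x : ℂ))⁻¹) =
        (((d.ξ : ℤ) : ℂ) / (Real.sqrt (Fintype.card A) : ℂ)) *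
        (((d.ξ : ℤ) : ℂ) / (Real.sqrt (Fintype.card A) : ℂ)) * (d.χ (e' * e⁻¹) x : ℂ) := by
      intro x
      rw [conj_χ]
      simp
      ring
    rw [Finset.sum_congr rfl fun x _ => hx x, ← Finset.mul_sum, d.sum_char]
    have hw : e' * e⁻¹ = 1 ↔ e = e' := by rw [mul_inv_eq_one, eq_comm]
    simp only [hw]
    split_ifs
    · exact d.coeff_sq
    · simp
  · rw [conj_χ]; simp
  · have hx : ∀ g, w = x * g ↔ x⁻¹ * w = g := fun g => by
      rw [inv_mul_eq_iff_eq_mul]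
    simp [hx]
  · rw [conj_χ]; simp
  · simp [eq_comm]
  · simp only [mul_assoc, if_true]
    by_cases h : x * y = e'
    · subst h; simp
    · simp [h, Ne.symm h]

theorem star_fSymbol_mul (d : TYData A) : ∀ x y z w f f' : Option A,
    f ∈ fuse y z → w ∈ fuse x f →
    ∑ e, conj (d.fSymbol x y z w e f) * d.fSymbol x y z w e f' = if f = f' then 1 else 0 := by
  intro x y z w f f' h1 h2
  rcases x with _ | x <;> rcases y with _ | y <;> rcases z with _ | z <;>
  rcases w with _ | w <;> rcases f with _ | f <;> rcases f' with _ | f' <;>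
  simp [fuse] at h1 h2 <;>
  simp [fSymbol_eq, fuse, assocCoeff, Fintype.sum_option, *]
  · have hx : ∀ x, ((d.ξ : ℤ) : ℂ) / (Real.sqrt (Fintype.card A) : ℂ) * (conj (d.χ x f : ℂ))⁻¹ *
        (((d.ξ : ℤ) : ℂ) / (Real.sqrt (Fintype.card A) : ℂ) * (d.χ x f' : ℂ)⁻¹) =
        (((d.ξ : ℤ) : ℂ) / (Real.sqrt (Fintype.card A) : ℂ)) *
        (((d.ξ : ℤ) : ℂ) / (Real.sqrt (Fintype.card A) : ℂ)) * (d.χ (f * f'⁻¹) x : ℂ) := by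
      intro x
      rw [conj_χ, d.symm x f, d.symm x f']
      simp
      ring
    rw [Finset.sum_congr rfl fun x _ => hx x, ← Finset.mul_sum, d.sum_char]
    simp only [mul_inv_eq_one]
    split_ifs
    · exact d.coeff_sq
    · simp
  · have hx : ∀ g, w = g * z ↔ w * z⁻¹ = g := fun g => by
      rw [mul_inv_eq_iff_eq_mul]
    simp [hx]
  · rw [conj_χ]; simp
  · simp [eq_comm]
  · rw [conj_χ]; simp
  · simp [mul_assoc, eq_comm]

/-- The system of fusion rules and `F`-symbols of `TY(A, χ, ξ)`. -/
def system (d : TYData A) : FusionSystem (Option A) where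
  one := some 1
  N := fuse
  F := d.fSymbol
  N_one_left := by rintro (_ | x) <;> simp [fuse]
  N_one_right := by rintro (_ | x) <;> simp [fuse]
  F_eq_zero := fun _ _ _ _ _ _ h => if_neg h
  F_one := by
    rintro (_ | x) (_ | y) (_ | w) h <;> simp_all [fuse, fSymbol, assocCoeff]
  F_mul_star := d.fSymbol_mul_star
  star_F_mul := d.star_fSymbol_mul
  pentagon := d.pentagon_fSymbol

/-- The Tambara-Yamagami category `TY(A, χ, ξ)`. -/
abbrev TY (d : TYData A) : Type (u + 1) := d.system.Obj

/-- With conjugate transposes as adjoints, `TY(A, χ, ξ)` is a unitary fusion category. -/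
instance (d : TYData A) : UnitaryFusionCategory d.TY := by
  have hξ : ((d.ξ : ℤ) : ℂ) ≠ 0 := by
    rcases Int.units_eq_one_or d.ξ with h | h <;> simp [h]
  have hn : (Real.sqrt (Fintype.card A) : ℂ) ≠ 0 := by
    simp
  have hconj : conj ((d.ξ : ℤ) : ℂ) = ((d.ξ : ℤ) : ℂ) := by
    rcases Int.units_eq_one_or d.ξ with h | h <;> simp [h]
  refine FusionSystem.unitaryFusionCategory d.system (Option.map fun a => a⁻¹)
    (fun x => x.elim ((Real.sqrt (Fintype.card A) : ℂ) / ((d.ξ : ℤ) : ℂ)) fun _ => 1) ?_ ?_ ?_ ?_ <;>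
  rintro (_ | x) <;> simp [system, fuse, fSymbol_eq, assocCoeff, hconj]

end TYData

end TambaraYamagami

end

open TambaraYamagami

noncomputable section

namespace TambaraYamagami

open DaggerCategory

/-! Nothing in the argument is special to Tambara–Yamagami categories: any linear monoidal
equivalence between unitary fusion categories can be replaced by a unitary one. The theorem follows
by applying this to the composite equivalence through `d.TY`. The replacement has two stages, and
each takes the positive part out of an isomorphism.

The functor. A linear functor `F` and its conjugate `f ↦ dag (F.map (dag f))` agree on morphisms
between simple objects, since these are scalars or zero. Decomposing every object orthogonally into
simples, one obtains positive automorphisms `q X` forming a natural isomorphism from `F` to its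
conjugate (`exists_positive_intertwiner`). Conjugating `F` by the positive square roots of the `q X`
gives an isomorphic functor that preserves adjoints (`exists_iso_dagger_functor`).

The tensor structure. Let `G` be such a functor, full and monoidal. Each structure morphism is
replaced by the unitary factor of its polar decomposition (`exists_unitary_monoidal`). Polar
decompositions of isomorphisms are unique and natural (`IsPolar.unique`, `IsPolar.natural_unitary`),
so naturality is inherited. In a coherence diagram two structure morphisms are composed, and their
unitary factors multiply only if the positive factors, moved to a common object, commute
(`IsPolar.comp`). Fullness supplies this: the moved positive factor is the image of a morphism under
`G`, and the second structure morphism is natural with respect to it. Both sides of each diagram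
then have known polar decompositions, and uniqueness equates the unitary factors.

The analytic input is that intertwining the squares of positive elements implies intertwining the
elements themselves (`IsPositiveHom.comp_eq_comp_of_sq`). -/

theorem isIso_of_isIso_sq {C : Type u} [Category.{v} C] {X : C} (s : X ⟶ X)
    [IsIso (s ≫ s)] : IsIso s := by
  have : Mono s := mono_of_mono s s
  have : IsSplitEpi s := IsSplitEpi.mk' ⟨inv (s ≫ s) ≫ s, by simp⟩
  exact isIso_of_mono_of_isSplitEpi s

/-! ### Positive endomorphisms, unitaries and polar decompositions in a dagger category. -/

section Positive

variable {C : Type u} [Category.{v} C] [DaggerCategory C]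

/-- An endomorphism is positive if it is of the form `b ≫ dag b`. -/
def IsPositiveHom {X : C} (a : X ⟶ X) : Prop := ∃ b : X ⟶ X, a = b ≫ dag b

theorem IsPositiveHom.dag_eq {X : C} {a : X ⟶ X} (h : IsPositiveHom a) : dag a = a := by
  obtain ⟨b, rfl⟩ := h
  rw [dag_comp, dag_dag]

theorem isPositiveHom_id (X : C) : IsPositiveHom (𝟙 X) := ⟨𝟙 X, by rw [dag_id, Category.comp_id]⟩

theorem IsUnitaryHom.comp {X Y Z : C} {f : X ⟶ Y} {g : Y ⟶ Z} (hf : IsUnitaryHom f)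
    (hg : IsUnitaryHom g) : IsUnitaryHom (f ≫ g) := by
  constructor
  · rw [dag_comp, Category.assoc, ← Category.assoc g, hg.1, Category.id_comp, hf.1]
  · rw [dag_comp, Category.assoc, ← Category.assoc _ f, hf.2, Category.id_comp, hg.2]

theorem IsUnitaryHom.isIso {X Y : C} {f : X ⟶ Y} (hf : IsUnitaryHom f) : IsIso f :=
  ⟨DaggerCategory.dag f, hf.1, hf.2⟩

theorem isIso_dag {X Y : C} (f : X ⟶ Y) [IsIso f] : IsIso (dag f) :=
  ⟨dag (inv f), by rw [← dag_comp, IsIso.inv_hom_id, dag_id],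
    by rw [← dag_comp, IsIso.hom_inv_id, dag_id]⟩

theorem dag_inv {X Y : C} (f : X ⟶ Y) [IsIso f] :
    dag (inv f) = @inv _ _ _ _ (dag f) (isIso_dag f) := by
  have := isIso_dag f
  rw [← cancel_mono (dag f), IsIso.inv_hom_id, ← dag_comp, IsIso.hom_inv_id, dag_id]

theorem IsPositiveHom.dag_inv {X : C} {s : X ⟶ X} (hs : IsPositiveHom s) [IsIso s] :
    DaggerCategory.dag (inv s) = inv s := by
  rw [TambaraYamagami.dag_inv]
  simp only [hs.dag_eq]

theorem IsPositiveHom.conj_unitary {X Y : C} {a : X ⟶ X} (ha : IsPositiveHom a) {u : Y ⟶ X}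
    (hu : IsUnitaryHom u) : IsPositiveHom (u ≫ a ≫ DaggerCategory.dag u) := by
  obtain ⟨b, rfl⟩ := ha
  refine ⟨u ≫ b ≫ DaggerCategory.dag u, ?_⟩
  simp only [dag_comp, dag_dag, Category.assoc]
  rw [← Category.assoc (DaggerCategory.dag u) u, hu.2, Category.id_comp]

/-- A polar decomposition of `f`: a positive endomorphism followed by a unitary morphism. -/
structure IsPolar {X Y : C} (f : X ⟶ Y) (s : X ⟶ X) (w : X ⟶ Y) : Prop where
  pos : IsPositiveHom s
  unitary : IsUnitaryHom w
  eq : f = s ≫ w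

namespace IsPolar

variable {X Y : C} {f : X ⟶ Y} {s : X ⟶ X} {w : X ⟶ Y}

theorem sq_eq (h : IsPolar f s w) : s ≫ s = f ≫ dag f := by
  rw [h.eq, dag_comp, h.pos.dag_eq, Category.assoc, ← Category.assoc w, h.unitary.1,
    Category.id_comp]

theorem isIso_left (h : IsPolar f s w) [IsIso f] : IsIso s := by
  have := h.unitary.isIso
  have h1 : s = f ≫ inv w := by rw [h.eq]; simp
  rw [h1]; infer_instance

theorem of_unitary (hw : IsUnitaryHom w) : IsPolar w (𝟙 X) w :=
  ⟨isPositiveHom_id X, hw, (Category.id_comp w).symm⟩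

theorem comp_unitary (h : IsPolar f s w) {Z : C} {z : Y ⟶ Z} (hz : IsUnitaryHom z) :
    IsPolar (f ≫ z) s (w ≫ z) :=
  ⟨h.pos, h.unitary.comp hz, by rw [h.eq, Category.assoc]⟩

theorem unitary_comp (h : IsPolar f s w) {Z : C} {z : Z ⟶ X} (hz : IsUnitaryHom z) :
    IsPolar (z ≫ f) (z ≫ s ≫ dag z) (z ≫ w) :=
  ⟨h.pos.conj_unitary hz, hz.comp h.unitary, by
    rw [h.eq]
    simp only [Category.assoc]
    rw [← Category.assoc (dag z) z, hz.2, Category.id_comp]⟩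

end IsPolar

end Positive

/-! ### Positivity in C*-categories; existence, uniqueness and naturality of polar decompositions.
-/

section Linear

variable {C : Type u} [Category.{v} C] [Preadditive C] [Linear ℂ C] [DaggerCategory C]
  [CStarCategory C]

theorem dag_zero (X Y : C) : dag (0 : X ⟶ Y) = 0 := by
  have h := CStarCategory.dag_smul (0 : ℂ) (0 : X ⟶ Y)
  simpa using h

theorem dag_neg {X Y : C} (f : X ⟶ Y) : dag (-f) = -dag f := by
  have h := CStarCategory.dag_smul (-1 : ℂ) f
  simpa using h

theorem dag_sum {X Y : C} {ι : Type*} (s : Finset ι) (f : ι → (X ⟶ Y)) :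
    dag (∑ i ∈ s, f i) = ∑ i ∈ s, dag (f i) := by
  classical
  induction s using Finset.induction_on with
  | empty => simp [dag_zero]
  | insert a s ha ih => rw [Finset.sum_insert ha, Finset.sum_insert ha, CStarCategory.dag_add, ih]

theorem eq_zero_of_comp_dag_eq_zero {X Y : C} {f : X ⟶ Y} (h : f ≫ dag f = 0) : f = 0 := by
  obtain ⟨ν, h0, -, -, -, h4⟩ := CStarCategory.exists_norm (C := C)
  have h5 := h4 f
  rw [h, (h0 _).2.2 rfl] at h5
  exact (h0 f).2.1 (by simpa using h5.symm)

theorem isPositiveHom_comp_dag {X Y : C} (f : X ⟶ Y) : IsPositiveHom (f ≫ dag f) :=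
  CStarCategory.exists_comp_dag_eq f

/-- This is the bridge to C*-algebra theory: square roots, sums and commuting products of positive
endomorphisms are all obtained through it. Finite dimension makes the norm complete. The algebra is
hidden behind an existential so that its norm and order, which are chosen rather than canonical,
stay local to each use. -/
theorem exists_cstarAlgebra (X : C) [FiniteDimensional ℂ (X ⟶ X)] :
    ∃ (B : Type v) (_ : CStarAlgebra B) (_ : PartialOrder B) (_ : StarOrderedRing B)
      (e : (X ⟶ X) ≃+ B), (∀ f g, e (f ≫ g) = e g * e f) ∧ (∀ f, e (dag f) = star (e f)) ∧
      ∀ f, IsPositiveHom f ↔ 0 ≤ e f := by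
  obtain ⟨ν, h0, h1, h2, h3, h4⟩ := CStarCategory.exists_norm (C := C)
  let N : RingNorm (End X) :=
    { toFun := fun f => ν f
      map_zero' := (h0 _).2.2 rfl
      add_le' := fun f g => h1 f g
      neg' := fun f => by
        have := h2 (-1 : ℂ) f
        simpa using this
      mul_le' := fun f g => (h3 g f).trans_eq (mul_comm _ _)
      eq_zero_of_map_eq_zero' := fun f hf => (h0 f).2.1 hf }
  let i1 : NormedRing (End X) := N.toNormedRing
  let i2 : NormedAlgebra ℂ (End X) := { (inferInstance : Algebra ℂ (End X)) with
    norm_smul_le := fun c f => (h2 c f).le }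
  let i3 : StarRing (End X) :=
    { star := fun f => dag f
      star_involutive := fun f => dag_dag f
      star_mul := fun f g => dag_comp g f
      star_add := fun f g => CStarCategory.dag_add f g }
  have i4 : CStarRing (End X) := ⟨fun f => by
    refine (le_of_eq ?_ : ν f * ν f ≤ ν (f ≫ dag f))
    rw [h4, sq]⟩
  have i5 : StarModule ℂ (End X) := ⟨fun c f => CStarCategory.dag_smul c f⟩
  have i6 : FiniteDimensional ℂ (End X) := ‹FiniteDimensional ℂ (X ⟶ X)›
  have i7 : CompleteSpace (End X) := FiniteDimensional.complete ℂ (End X)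
  let A : CStarAlgebra (End X) := {}
  let P : PartialOrder (End X) := CStarAlgebra.spectralOrder _
  have hP : StarOrderedRing (End X) := CStarAlgebra.spectralOrderedRing _
  -- Multiplication in `End X` reverses diagrammatic order, so `star b * b` is `b ≫ dag b`, which is
  -- the form in `IsPositiveHom`.
  exact ⟨End X, A, P, hP, AddEquiv.refl _, fun _ _ => rfl, fun _ => rfl, fun _ =>
    (CStarAlgebra.nonneg_iff_eq_star_mul_self (A := End X)).symm⟩

theorem IsPositiveHom.exists_sqrt {X : C} [FiniteDimensional ℂ (X ⟶ X)] {a : X ⟶ X}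
    (ha : IsPositiveHom a) : ∃ s : X ⟶ X, IsPositiveHom s ∧ s ≫ s = a := by
  obtain ⟨B, _, _, _, e, he, -, hpos⟩ := exists_cstarAlgebra X
  refine ⟨e.symm (CFC.sqrt (e a)), (hpos _).2 ?_, e.injective ?_⟩
  · rw [e.apply_symm_apply]
    exact CFC.sqrt_nonneg _
  · rw [he, e.apply_symm_apply]
    exact CFC.sqrt_mul_sqrt_self _ ((hpos _).1 ha)

theorem isPositiveHom_sum {X : C} [FiniteDimensional ℂ (X ⟶ X)] {ι : Type*} (s : Finset ι)
    (a : ι → (X ⟶ X)) (ha : ∀ i, IsPositiveHom (a i)) : IsPositiveHom (∑ i ∈ s, a i) := by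
  obtain ⟨B, _, _, _, e, -, -, hpos⟩ := exists_cstarAlgebra X
  rw [hpos, map_sum]
  exact Finset.sum_nonneg fun i _ => (hpos _).1 (ha i)

theorem IsPositiveHom.eq_zero_of_neg {X : C} [FiniteDimensional ℂ (X ⟶ X)] {a : X ⟶ X}
    (ha : IsPositiveHom a) (hb : IsPositiveHom (-a)) : a = 0 := by
  obtain ⟨B, _, _, _, e, -, -, hpos⟩ := exists_cstarAlgebra X
  rw [hpos] at *
  rw [map_neg, neg_nonneg] at hb
  exact (map_eq_zero_iff e e.injective).1 (le_antisymm hb ha)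

theorem IsPositiveHom.comp_of_commute {X : C} [FiniteDimensional ℂ (X ⟶ X)] {a b : X ⟶ X}
    (ha : IsPositiveHom a) (hb : IsPositiveHom b) (h : a ≫ b = b ≫ a) :
    IsPositiveHom (a ≫ b) := by
  obtain ⟨B, _, _, _, e, he, -, hpos⟩ := exists_cstarAlgebra X
  rw [hpos] at *
  rw [he]
  exact Commute.mul_nonneg hb ha (by rw [Commute, SemiconjBy, ← he, ← he, h])

/-- A Sylvester equation with positive coefficients, one of them invertible, has only the trivial
solution. Writing `t = q ≫ q`, the equation turns the positive morphism `(k ≫ q) ≫ dag (k ≫ q)` into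
the negative of `s ≫ k ≫ dag k`. The latter is itself positive, being a product of commuting
positive elements, so both vanish. -/
theorem eq_zero_of_comp_add_comp_eq_zero {X Y : C} [FiniteDimensional ℂ (X ⟶ X)]
    [FiniteDimensional ℂ (Y ⟶ Y)] {s : X ⟶ X} {t : Y ⟶ Y}
    (hs : IsPositiveHom s) (ht : IsPositiveHom t) [IsIso t] {k : X ⟶ Y}
    (h : s ≫ k + k ≫ t = 0) : k = 0 := by
  obtain ⟨q, hq, rfl⟩ := ht.exists_sqrt
  have hk : s ≫ k = -(k ≫ q ≫ q) := eq_neg_of_add_eq_zero_left h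
  have hp : (k ≫ q) ≫ dag (k ≫ q) = -(s ≫ k ≫ dag k) := by
    rw [← Category.assoc s, hk, dag_comp, hq.dag_eq, Preadditive.neg_comp, neg_neg]
    simp only [Category.assoc]
  -- By `hp` the product is self-adjoint, and a self-adjoint product of two self-adjoint elements is
  -- a commuting product.
  have hcomm : s ≫ k ≫ dag k = (k ≫ dag k) ≫ s := by
    have h1 := (isPositiveHom_comp_dag (k ≫ q)).dag_eq
    rw [hp, dag_neg, neg_inj] at h1
    rw [← h1]
    simp only [dag_comp, dag_dag, hs.dag_eq]
  have h2 := hs.comp_of_commute (isPositiveHom_comp_dag k) hcomm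
  have h3 := h2.eq_zero_of_neg (by rw [← hp]; exact isPositiveHom_comp_dag _)
  rw [h3, neg_zero] at hp
  have h4 := eq_zero_of_comp_dag_eq_zero hp
  rw [← cancel_mono (q ≫ q), ← Category.assoc, h4, Limits.zero_comp, Limits.zero_comp]

/-- A morphism that intertwines the squares of two positive endomorphisms intertwines them. -/
theorem IsPositiveHom.comp_eq_comp_of_sq {X Y : C} [FiniteDimensional ℂ (X ⟶ X)]
    [FiniteDimensional ℂ (Y ⟶ Y)] {s : X ⟶ X} {t : Y ⟶ Y}
    (hs : IsPositiveHom s) (ht : IsPositiveHom t) [IsIso t] {k : X ⟶ Y}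
    (h : (s ≫ s) ≫ k = k ≫ t ≫ t) : s ≫ k = k ≫ t := by
  -- The difference `s ≫ k - k ≫ t` solves the Sylvester equation: the mixed terms cancel and what
  -- remains is the hypothesis on squares.
  refine sub_eq_zero.1 (eq_zero_of_comp_add_comp_eq_zero hs ht ?_)
  rw [Preadditive.comp_sub, Preadditive.sub_comp, ← Category.assoc s s, h]
  simp only [Category.assoc]
  abel

/-- The positive part is the square root `s` of `f ≫ dag f`. It is invertible because its square is,
so the unitary part is `inv s ≫ f`. -/
theorem exists_isPolar {X Y : C} [FiniteDimensional ℂ (X ⟶ X)] (f : X ⟶ Y) [IsIso f] :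
    ∃ s w, IsPolar f s w := by
  obtain ⟨s, hs, hsq⟩ := (isPositiveHom_comp_dag f).exists_sqrt
  have := isIso_dag f
  have hiso : IsIso (s ≫ s) := by rw [hsq]; infer_instance
  have := isIso_of_isIso_sq s
  refine ⟨s, inv s ≫ f, hs, ⟨?_, ?_⟩, by simp⟩
  · rw [dag_comp, hs.dag_inv, Category.assoc, ← Category.assoc f, ← hsq]
    simp
  · rw [dag_comp, hs.dag_inv, ← cancel_epi f]
    simp only [Category.assoc, Category.comp_id]
    rw [← Category.assoc f, ← hsq]
    simp

namespace IsPolar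

variable {X Y : C} {f : X ⟶ Y} {s : X ⟶ X} {w : X ⟶ Y}

/-- Compatibility is required of `a`, `b` and also of their adjoints: together the two squares show
that `a` intertwines `f ≫ dag f` with `g ≫ dag g`, that is, the squares of the positive parts. -/
theorem natural [FiniteDimensional ℂ (X ⟶ X)] (hf : IsPolar f s w) {X' Y' : C}
    [FiniteDimensional ℂ (X' ⟶ X')] {g : X' ⟶ Y'} {t : X' ⟶ X'} {z : X' ⟶ Y'} [IsIso g]
    (hg : IsPolar g t z) {a : X ⟶ X'} {b : Y ⟶ Y'} (h : a ≫ g = f ≫ b)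
    (h' : dag a ≫ f = g ≫ dag b) : s ≫ a = a ≫ t := by
  have := hg.isIso_left
  refine hf.pos.comp_eq_comp_of_sq hg.pos ?_
  rw [hf.sq_eq, hg.sq_eq, ← Category.assoc a, h, Category.assoc, Category.assoc]
  congr 1
  simpa only [dag_comp, dag_dag] using congrArg dag h'

theorem natural_unitary [FiniteDimensional ℂ (X ⟶ X)] [IsIso f] (hf : IsPolar f s w) {X' Y' : C}
    [FiniteDimensional ℂ (X' ⟶ X')] {g : X' ⟶ Y'} {t : X' ⟶ X'} {z : X' ⟶ Y'} [IsIso g]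
    (hg : IsPolar g t z) {a : X ⟶ X'} {b : Y ⟶ Y'} (h : a ≫ g = f ≫ b)
    (h' : dag a ≫ f = g ≫ dag b) : a ≫ z = w ≫ b := by
  have := hf.isIso_left
  rw [← cancel_epi s, ← Category.assoc, ← Category.assoc, ← hf.eq, hf.natural hg h h',
    Category.assoc, ← hg.eq, h]

/-- Naturality along identities, applied to two polar decompositions of the same isomorphism. -/
theorem unique [FiniteDimensional ℂ (X ⟶ X)] [IsIso f] (hf : IsPolar f s w) {t : X ⟶ X}
    {z : X ⟶ Y} (hg : IsPolar f t z) : w = z := by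
  simpa using (hf.natural_unitary hg (a := 𝟙 X) (b := 𝟙 Y) (by simp) (by simp [dag_id])).symm

/-- Unitary parts are not multiplicative in general. The hypothesis says that the positive part of
`f`, carried to `Y` by `w`, commutes with that of `g`. Carried back to `X`, the two positive parts
then have a positive product. -/
theorem comp [FiniteDimensional ℂ (X ⟶ X)] (hf : IsPolar f s w) {Z : C} {g : Y ⟶ Z}
    {t : Y ⟶ Y} {z : Y ⟶ Z} (hg : IsPolar g t z)
    (h : (dag w ≫ s ≫ w) ≫ t = t ≫ dag w ≫ s ≫ w) :
    IsPolar (f ≫ g) (s ≫ w ≫ t ≫ dag w) (w ≫ z) := by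
  refine ⟨hf.pos.comp_of_commute (hg.pos.conj_unitary hf.unitary) ?_, hf.unitary.comp hg.unitary, ?_⟩
  · have h1 := congrArg (fun k => w ≫ k ≫ dag w) h
    have hw : ∀ {Q : C} (q : X ⟶ Q), w ≫ dag w ≫ q = q := fun q => by
      rw [← Category.assoc, hf.unitary.1, Category.id_comp]
    simp only [Category.assoc, hw] at h1
    rw [hf.unitary.1, Category.comp_id] at h1
    simpa only [Category.assoc] using h1
  · have hw : ∀ {Q : C} (q : Y ⟶ Q), dag w ≫ w ≫ q = q := fun q => by
      rw [← Category.assoc, hf.unitary.2, Category.id_comp]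
    simp only [Category.assoc, hw]
    rw [hf.eq, hg.eq, Category.assoc]

end IsPolar

end Linear

/-! ### Orthogonal decomposition into simples, and replacing a linear functor by one that preserves
adjoints. -/

section Semisimple

/-- Morphisms between direct sums of simples are determined by finitely many matrix entries, each
lying in a space of dimension at most one. -/
theorem finiteDimensional_hom {C : Type u} [Category.{v} C] [Preadditive C] [Linear ℂ C]
    [MonoidalCategory C] [FusionCategory C] (X Y : C) : FiniteDimensional ℂ (X ⟶ Y) := by
  obtain ⟨m, S, hS, hSS, hX⟩ := FusionCategory.semisimple (C := C)
  have hfin : ∀ i j, FiniteDimensional ℂ (S i ⟶ S j) := by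
    intro i j
    by_cases h : i = j
    · subst h
      refine .of_surjective (LinearMap.toSpanSingleton ℂ (S i ⟶ S i) (𝟙 _)) fun f => ?_
      obtain ⟨c, hc⟩ := (hS i).2 f
      exact ⟨c, by simp [hc]⟩
    · have : Subsingleton (S i ⟶ S j) := ⟨fun f g => by rw [hSS i j h f, hSS i j h g]⟩
      infer_instance
  obtain ⟨n, c, ⟨e⟩⟩ := hX X
  obtain ⟨n', c', ⟨e'⟩⟩ := hX Y
  let Φ : (X ⟶ Y) →ₗ[ℂ] ∀ (k : Fin n) (l : Fin n'), S (c k) ⟶ S (c' l) :=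
    { toFun := fun f k l => Limits.biproduct.ι (fun k => S (c k)) k ≫ e.inv ≫ f ≫ e'.hom ≫
        Limits.biproduct.π (fun k => S (c' k)) l
      map_add' := fun f g => by ext; simp
      map_smul' := fun r f => by ext; simp }
  refine .of_injective Φ fun f g h => ?_
  rw [← cancel_epi e.inv, ← cancel_mono e'.hom]
  ext k l
  simp only [Category.assoc]
  exact congrFun (congrFun h l) k

theorem exists_orthonormal_basis {V : Type*} [AddCommGroup V] [Module ℂ V] [FiniteDimensional ℂ V]
    (core : InnerProductSpace.Core ℂ V) :
    ∃ (n : ℕ) (b : Fin n → V), (∀ i j, core.inner (b i) (b j) = if i = j then 1 else 0) ∧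
      ∀ x, ∑ i, core.inner (b i) x • b i = x := by
  let i1 : NormedAddCommGroup V := core.toNormedAddCommGroup
  let i2 : InnerProductSpace ℂ V := .ofCore core.toCore
  let b := stdOrthonormalBasis ℂ V
  exact ⟨_, b, fun i j => orthonormal_iff_ite.1 b.orthonormal i j, fun x => b.sum_repr' x⟩

section

variable {C : Type u} [Category.{v} C] [Preadditive C] [Linear ℂ C] [DaggerCategory C]
  [CStarCategory C]

/-- Since endomorphisms of `S` are scalars, `g ≫ dag f` defines an inner product on `S ⟶ X`, and an
orthonormal basis for it has the required properties. The elements `dag (b i) ≫ b i` add up to the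
projection onto the part of `X` isotypic for `S`. -/
theorem exists_orthonormal_homs {S X : C} (hS : IsSimpleObj S) [FiniteDimensional ℂ (S ⟶ X)] :
    ∃ (n : ℕ) (b : Fin n → (S ⟶ X)), (∀ i j, b i ≫ dag (b j) = if i = j then 𝟙 S else 0) ∧
      ∀ g : S ⟶ X, ∑ i, g ≫ dag (b i) ≫ b i = g := by
  choose φ hφ using hS.2
  have huniq : ∀ (f : S ⟶ S) (c : ℂ), f = c • 𝟙 S → φ f = c := fun f c h => by
    have h1 := (hφ f).symm.trans h
    rw [← sub_eq_zero, ← sub_smul, smul_eq_zero, sub_eq_zero] at h1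
    exact h1.resolve_right hS.1
  have hsmul : ∀ (f : S ⟶ S) {Y : C} (g : S ⟶ Y), f ≫ g = φ f • g := fun f Y g => by
    conv_lhs => rw [hφ f, Linear.smul_comp, Category.id_comp]
  let core : InnerProductSpace.Core ℂ (S ⟶ X) :=
    { inner := fun f g => φ (g ≫ dag f)
      conj_inner_symm := fun f g => by
        refine (huniq _ _ ?_).symm
        have h1 : g ≫ dag f = dag (f ≫ dag g) := by rw [dag_comp, dag_dag]
        conv_lhs => rw [h1, hφ (f ≫ dag g), CStarCategory.dag_smul, dag_id]
      -- The C*-axiom replaces `f ≫ dag f` by `g ≫ dag g` with `g` an endomorphism of `S`, hence a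
      -- scalar, so the value is a squared modulus.
      re_inner_nonneg := fun f => by
        obtain ⟨g, hg⟩ := CStarCategory.exists_comp_dag_eq f
        have h1 : φ (f ≫ dag f) = φ g * conj (φ g) := by
          apply huniq
          conv_lhs => rw [hg, hφ g, CStarCategory.dag_smul, dag_id]
          rw [Linear.smul_comp, Linear.comp_smul, Category.comp_id, smul_smul]
        rw [h1, Complex.mul_conj]
        simp [Complex.normSq_nonneg]
      add_left := fun f g h => by
        apply huniq
        rw [CStarCategory.dag_add, Preadditive.comp_add, add_smul, ← hφ, ← hφ]
      smul_left := fun f g r => by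
        apply huniq
        rw [CStarCategory.dag_smul, Linear.comp_smul, mul_smul, ← hφ]
      definite := fun f h => eq_zero_of_comp_dag_eq_zero (by
        rw [hφ (f ≫ dag f)]
        erw [h]
        rw [zero_smul]) }
  obtain ⟨n, b, h1, h2⟩ := exists_orthonormal_basis core
  refine ⟨n, b, fun i j => ?_, fun g => ?_⟩
  · have h3 : φ (b i ≫ dag (b j)) = if j = i then 1 else 0 := h1 j i
    rw [hφ (b i ≫ dag (b j)), h3]
    simp only [eq_comm (a := j)]
    split_ifs <;> simp
  · conv_rhs => rw [← h2 g]
    refine Finset.sum_congr rfl fun i _ => ?_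
    rw [← Category.assoc, hsmul]
    rfl

end

/-- In a fusion category with a `C*`-structure, the simple objects can be chosen so that every object
is their orthogonal direct sum. -/
theorem exists_orthogonal_decomposition (C : Type u) [Category.{v} C] [Preadditive C] [Linear ℂ C]
    [MonoidalCategory C] [DaggerCategory C] [FusionCategory C] [CStarCategory C] :
    ∃ (m : ℕ) (S : Fin m → C), (∀ i, IsSimpleObj (S i)) ∧
      (∀ i j, i ≠ j → ∀ f : S i ⟶ S j, f = 0) ∧
      ∀ X : C, ∃ (n : ℕ) (c : Fin n → Fin m) (b : ∀ k, S (c k) ⟶ X),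
        (∀ k, b k ≫ dag (b k) = 𝟙 _) ∧ (∀ k l, k ≠ l → b k ≫ dag (b l) = 0) ∧
        ∑ k, dag (b k) ≫ b k = 𝟙 X := by
  obtain ⟨m, S, hS, hSS, hX⟩ := FusionCategory.semisimple (C := C)
  refine ⟨m, S, hS, hSS, fun X => ?_⟩
  have := fun i => finiteDimensional_hom (S i) X
  choose n b h1 h2 using fun i => exists_orthonormal_homs (X := X) (hS i)
  have key : ∀ j (g : S j ⟶ X), g ≫ ∑ i, ∑ k, dag (b i k) ≫ b i k = g := by
    intro j g
    simp only [Preadditive.comp_sum]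
    rw [Finset.sum_eq_single j (fun i _ hi => Finset.sum_eq_zero fun k _ => by
      rw [← Category.assoc, hSS j i hi.symm (g ≫ _), Limits.zero_comp]) (by simp), h2]
  obtain ⟨N, c, ⟨e⟩⟩ := hX X
  -- By `key` the sum fixes every morphism into `X` from a chosen simple. The possibly
  -- non-orthogonal decomposition `e` shows that such morphisms detect equality.
  have hsum : ∑ i, ∑ k, dag (b i k) ≫ b i k = 𝟙 X := by
    rw [← cancel_epi e.inv, Category.comp_id]
    ext k
    rw [← Category.assoc, key]
  let κ := Σ i, Fin (n i)
  let ε : κ ≃ Fin (Fintype.card κ) := Fintype.equivFin κ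
  have horth : ∀ k l : κ, k ≠ l → b k.1 k.2 ≫ dag (b l.1 l.2) = 0 := by
    rintro ⟨i, k⟩ ⟨j, l⟩ hkl
    by_cases h : i = j
    · subst h
      exact (h1 i k l).trans (if_neg fun h => hkl (by rw [h]))
    · exact hSS i j h _
  refine ⟨_, fun k => (ε.symm k).1, fun k => b (ε.symm k).1 (ε.symm k).2,
    fun k => by rw [h1, if_pos rfl], fun k l hkl => horth _ _ (ε.symm.injective.ne hkl), ?_⟩
  rw [← hsum, Equiv.sum_comp ε.symm fun k : κ => dag (b k.1 k.2) ≫ b k.1 k.2,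
    Fintype.sum_sigma]

variable {C : Type u₁} [Category.{v₁} C] [Preadditive C] [Linear ℂ C]
  [MonoidalCategory C] [DaggerCategory C] [FusionCategory C] [CStarCategory C]
  {D : Type u₂} [Category.{v₂} D] [Preadditive D] [Linear ℂ D]
  [DaggerCategory D] [CStarCategory D]

/-- A linear functor is intertwined with its conjugate by the adjoints by positive automorphisms. -/
theorem exists_positive_intertwiner [∀ X Y : D, FiniteDimensional ℂ (X ⟶ Y)] (F : C ⥤ D)
    [F.Additive] [F.Linear ℂ] :
    ∃ q : ∀ X : C, F.obj X ⟶ F.obj X, (∀ X, IsPositiveHom (q X) ∧ IsIso (q X)) ∧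
      ∀ {X Y : C} (f : X ⟶ Y), F.map f ≫ q Y = q X ≫ dag (F.map (dag f)) := by
  obtain ⟨m, S, hS, hSS, hX⟩ := exists_orthogonal_decomposition C
  choose n c b h1 h2 h3 using hX
  -- On simples, `F` and its conjugate agree: a scalar is conjugated twice.
  have hdag : ∀ i j (f : S i ⟶ S j), dag (F.map (dag f)) = F.map f := by
    intro i j f
    by_cases h : i = j
    · subst h
      obtain ⟨c, rfl⟩ := (hS i).2 f
      simp [CStarCategory.dag_smul, dag_id]
    · rw [hSS i j h f, dag_zero, F.map_zero, F.map_zero, dag_zero]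
  -- On each simple summand the identity intertwines the two functors by `hdag`. The summands are
  -- included and projected by `F` on one side and by its conjugate on the other, which makes `q X`
  -- a sum of positive terms.
  let q : ∀ X : C, F.obj X ⟶ F.obj X := fun X =>
    ∑ k, F.map (dag (b X k)) ≫ dag (F.map (dag (b X k)))
  have hexp : ∀ {X Y : C} (f : X ⟶ Y), F.map f = ∑ k, F.map (dag (b X k)) ≫ F.map (b X k ≫ f) := by
    intro X Y f
    conv_lhs => rw [← Category.id_comp f, ← h3, Preadditive.sum_comp, F.map_sum]
    simp only [Category.assoc, F.map_comp]
  have hnat : ∀ {X Y : C} (f : X ⟶ Y), F.map f ≫ q Y = q X ≫ dag (F.map (dag f)) := by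
    intro X Y f
    have hl : ∀ l, F.map f ≫ F.map (dag (b Y l)) ≫ dag (F.map (dag (b Y l))) =
        ∑ k, F.map (dag (b X k)) ≫ F.map (b X k ≫ f ≫ dag (b Y l)) ≫
          dag (F.map (dag (b Y l))) := by
      intro l
      rw [← Category.assoc, ← F.map_comp, hexp, Preadditive.sum_comp]
      simp only [Category.assoc]
    have hr : ∀ k, (F.map (dag (b X k)) ≫ dag (F.map (dag (b X k)))) ≫ dag (F.map (dag f)) =
        ∑ l, F.map (dag (b X k)) ≫ F.map (b X k ≫ f ≫ dag (b Y l)) ≫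
          dag (F.map (dag (b Y l))) := by
      intro k
      rw [Category.assoc, ← dag_comp, ← F.map_comp, hexp (dag f ≫ dag (b X k)),
        dag_sum, Preadditive.comp_sum]
      refine Finset.sum_congr rfl fun l _ => ?_
      rw [dag_comp, ← hdag _ _ (b X k ≫ f ≫ dag (b Y l))]
      simp only [dag_comp, dag_dag, Category.assoc]
    rw [Preadditive.comp_sum, Preadditive.sum_comp, Finset.sum_congr rfl fun l _ => hl l,
      Finset.sum_congr rfl fun k _ => hr k, Finset.sum_comm]
  -- The inverse is obtained by exchanging the roles of `F` and its conjugate; orthonormality of the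
  -- `b X k` collapses the double sums.
  refine ⟨q, fun X => ⟨isPositiveHom_sum _ _ fun k => isPositiveHom_comp_dag _,
    ∑ k, dag (F.map (b X k)) ≫ F.map (b X k), ?_, ?_⟩, hnat⟩
  · rw [Preadditive.sum_comp, ← F.map_id, ← h3, F.map_sum]
    refine Finset.sum_congr rfl fun k _ => ?_
    rw [Preadditive.comp_sum, Finset.sum_eq_single k]
    · rw [Category.assoc, ← Category.assoc (dag _), ← dag_comp, ← F.map_comp, h1, F.map_id, dag_id,
        Category.id_comp, F.map_comp]
    · intro l _ hl
      rw [Category.assoc, ← Category.assoc (dag _), ← dag_comp, ← F.map_comp, h2 _ _ _ hl,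
        F.map_zero, dag_zero, Limits.zero_comp, Limits.comp_zero]
    · simp
  · rw [Preadditive.sum_comp, ← dag_id, ← F.map_id, ← h3, F.map_sum, dag_sum]
    refine Finset.sum_congr rfl fun k _ => ?_
    rw [Preadditive.comp_sum, Finset.sum_eq_single k]
    · rw [Category.assoc, ← Category.assoc (F.map _), ← F.map_comp, h1, F.map_id,
        Category.id_comp, F.map_comp, dag_comp]
    · intro l _ hl
      rw [Category.assoc, ← Category.assoc (F.map _), ← F.map_comp, h2 _ _ _ hl.symm,
        F.map_zero, Limits.zero_comp, Limits.comp_zero]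
    · simp

/-- A linear functor is isomorphic to one that preserves adjoints. -/
theorem exists_iso_dagger_functor [∀ X Y : D, FiniteDimensional ℂ (X ⟶ Y)] (F : C ⥤ D)
    [F.Additive] [F.Linear ℂ] :
    ∃ (G : C ⥤ D) (_ : F ≅ G), G.Additive ∧ G.Linear ℂ ∧
      ∀ {X Y : C} (f : X ⟶ Y), G.map (dag f) = dag (G.map f) := by
  obtain ⟨q, hq, hnat⟩ := exists_positive_intertwiner F
  choose p hp hpq using fun X => (hq X).1.exists_sqrt
  have hiso : ∀ X, IsIso (p X) := fun X => by
    have := (hq X).2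
    rw [← hpq X] at this
    exact isIso_of_isIso_sq (p X)
  let G : C ⥤ D :=
    { obj := F.obj
      map := fun {X Y} f => inv (p X) ≫ F.map f ≫ p Y }
  refine ⟨G, NatIso.ofComponents (fun X => asIso (p X)) (fun f => by simp [G]), ⟨?_⟩, ⟨?_⟩, ?_⟩
  · simp [G]
  · simp [G]
  · intro X Y f
    have h := hnat f
    rw [← hpq, ← hpq] at h
    change inv (p Y) ≫ F.map (dag f) ≫ p X = dag (inv (p X) ≫ F.map f ≫ p Y)
    -- Half of the intertwiner `q = p ≫ p` is cancelled on each side. The resulting expression is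
    -- visibly the adjoint of the image of `dag f`, because `p` and its inverse are self-adjoint.
    have h' : inv (p X) ≫ F.map f ≫ p Y = p X ≫ dag (F.map (dag f)) ≫ inv (p Y) := by
      rw [IsIso.inv_comp_eq, ← cancel_mono (p Y)]
      simpa using h
    rw [h', dag_comp, dag_comp, dag_dag, (hp Y).dag_inv, (hp X).dag_eq, Category.assoc]

end Semisimple

/-! ### Compatibility of tensoring with adjoints and polar decompositions. -/

section Whisker

variable {C : Type u} [Category.{v} C] [Preadditive C] [Linear ℂ C] [MonoidalCategory C]
  [DaggerCategory C] [UnitaryFusionCategory C]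

theorem dag_whiskerRight {X Y : C} (f : X ⟶ Y) (Z : C) : dag (f ▷ Z) = dag f ▷ Z := by
  rw [← tensorHom_id, UnitaryFusionCategory.dag_tensor, dag_id, tensorHom_id]

theorem dag_whiskerLeft (Z : C) {X Y : C} (f : X ⟶ Y) : dag (Z ◁ f) = Z ◁ dag f := by
  rw [← id_tensorHom, UnitaryFusionCategory.dag_tensor, dag_id, id_tensorHom]

theorem IsPolar.whiskerRight {X Y : C} {f : X ⟶ Y} {s : X ⟶ X} {w : X ⟶ Y} (h : IsPolar f s w)
    (Z : C) : IsPolar (f ▷ Z) (s ▷ Z) (w ▷ Z) := by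
  obtain ⟨⟨b, rfl⟩, ⟨h1, h2⟩, rfl⟩ := h
  refine ⟨⟨b ▷ Z, ?_⟩, ⟨?_, ?_⟩, comp_whiskerRight _ _ _⟩
  · rw [dag_whiskerRight, comp_whiskerRight]
  · rw [dag_whiskerRight, ← comp_whiskerRight, h1, id_whiskerRight]
  · rw [dag_whiskerRight, ← comp_whiskerRight, h2, id_whiskerRight]

theorem IsPolar.whiskerLeft {X Y : C} {f : X ⟶ Y} {s : X ⟶ X} {w : X ⟶ Y} (h : IsPolar f s w)
    (Z : C) : IsPolar (Z ◁ f) (Z ◁ s) (Z ◁ w) := by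
  obtain ⟨⟨b, rfl⟩, ⟨h1, h2⟩, rfl⟩ := h
  refine ⟨⟨Z ◁ b, ?_⟩, ⟨?_, ?_⟩, MonoidalCategory.whiskerLeft_comp _ _ _⟩
  · rw [dag_whiskerLeft, MonoidalCategory.whiskerLeft_comp]
  · rw [dag_whiskerLeft, ← MonoidalCategory.whiskerLeft_comp, h1, MonoidalCategory.whiskerLeft_id]
  · rw [dag_whiskerLeft, ← MonoidalCategory.whiskerLeft_comp, h2, MonoidalCategory.whiskerLeft_id]

end Whisker

/-! ### Unitarizing the monoidal structure. -/

open Functor.LaxMonoidal in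
/-- A full monoidal functor between unitary fusion categories that preserves adjoints carries a
monoidal structure with unitary structure morphisms: the unitary parts of the given ones. -/
theorem exists_unitary_monoidal {C : Type u₁} [Category.{v₁} C] [Preadditive C] [Linear ℂ C]
    [MonoidalCategory C] [DaggerCategory C] [UnitaryFusionCategory C]
    {D : Type u₂} [Category.{v₂} D] [Preadditive D] [Linear ℂ D]
    [MonoidalCategory D] [DaggerCategory D] [UnitaryFusionCategory D]
    (G : C ⥤ D) [G.Monoidal] [G.Full]
    (hG : ∀ {X Y : C} (f : X ⟶ Y), G.map (dag f) = dag (G.map f)) :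
    ∃ _ : G.Monoidal, (∀ X Y, IsUnitaryHom (μ G X Y)) ∧ IsUnitaryHom (ε G) := by
  have hfin : ∀ X Y : D, FiniteDimensional ℂ (X ⟶ Y) := finiteDimensional_hom
  have hGu : ∀ {X Y : C} {f : X ⟶ Y}, IsUnitaryHom f → IsUnitaryHom (G.map f) := fun h =>
    ⟨by rw [← hG, ← G.map_comp, h.1, G.map_id], by rw [← hG, ← G.map_comp, h.2, G.map_id]⟩
  choose s w h using fun X Y => exists_isPolar (μ G X Y)
  obtain ⟨s₀, w₀, h₀⟩ := exists_isPolar (ε G)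
  have hl : ∀ {X Y : C} (f : X ⟶ Y) (Z : C), G.map f ▷ G.obj Z ≫ μ G Y Z =
      μ G X Z ≫ G.map (f ▷ Z) := fun f Z => μ_natural_left G f Z
  have hr : ∀ {X Y : C} (Z : C) (f : X ⟶ Y), G.obj Z ◁ G.map f ≫ μ G Z Y =
      μ G Z X ≫ G.map (Z ◁ f) := fun Z f => μ_natural_right G Z f
  -- The adjoint squares needed for `IsPolar.natural` are the naturality squares of `dag f`, because
  -- `G` and whiskering preserve adjoints.
  have hl' : ∀ {X Y : C} (f : X ⟶ Y) (Z : C), dag (G.map f ▷ G.obj Z) ≫ μ G X Z =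
      μ G Y Z ≫ dag (G.map (f ▷ Z)) := fun f Z => by
    rw [dag_whiskerRight, ← hG, hl, ← hG, dag_whiskerRight]
  have hr' : ∀ {X Y : C} (Z : C) (f : X ⟶ Y), dag (G.obj Z ◁ G.map f) ≫ μ G Z X =
      μ G Z Y ≫ dag (G.map (Z ◁ f)) := fun Z f => by
    rw [dag_whiskerLeft, ← hG, hr, ← hG, dag_whiskerLeft]
  obtain ⟨c, hc⟩ := (FusionCategory.simple_unit (C := D)).2 s₀
  have hα : ∀ X Y Z : C, w X Y ▷ G.obj Z ≫ w (X ⊗ Y) Z ≫ G.map (α_ X Y Z).hom =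
      (α_ (G.obj X) (G.obj Y) (G.obj Z)).hom ≫ G.obj X ◁ w Y Z ≫ w X (Y ⊗ Z) := by
    intro X Y Z
    have h1 := ((h X Y).whiskerRight (G.obj Z)).comp (h (X ⊗ Y) Z) (by
      -- Fullness enters here: the transported positive part is an endomorphism of `G.obj (X ⊗ Y)`,
      -- hence of the form `G.map f`. Naturality of `μ` in `f` then makes it commute, after
      -- whiskering, with the positive part of the next structure morphism.
      obtain ⟨f, hf⟩ := G.map_surjective (dag (w X Y) ≫ s X Y ≫ w X Y)
      rw [dag_whiskerRight, ← comp_whiskerRight, ← comp_whiskerRight, ← hf]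
      exact ((h (X ⊗ Y) Z).natural (h (X ⊗ Y) Z) (hl f Z) (hl' f Z)).symm)
    have h2 := ((h Y Z).whiskerLeft (G.obj X)).comp (h X (Y ⊗ Z)) (by
      obtain ⟨f, hf⟩ := G.map_surjective (dag (w Y Z) ≫ s Y Z ≫ w Y Z)
      rw [dag_whiskerLeft, ← MonoidalCategory.whiskerLeft_comp,
        ← MonoidalCategory.whiskerLeft_comp, ← hf]
      exact ((h X (Y ⊗ Z)).natural (h X (Y ⊗ Z)) (hr X f) (hr' X f)).symm)
    have h3 := h1.comp_unitary (hGu (UnitaryFusionCategory.associator_unitary X Y Z))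
    have h4 := h2.unitary_comp (UnitaryFusionCategory.associator_unitary (G.obj X) (G.obj Y)
      (G.obj Z))
    -- The old associativity identifies the morphisms decomposed in `h3` and `h4`, so their unitary
    -- parts coincide. Composing with the unitary associators has not disturbed the polar
    -- decompositions.
    have h5 := associativity G X Y Z
    rw [← Category.assoc] at h5
    rw [h5] at h3
    simpa only [Category.assoc] using h3.unique h4
  -- The unit is simple, so the positive part of `ε` is a scalar and the commutation hypothesis of
  -- `IsPolar.comp` is automatic in the unit diagrams.
  have hscal : dag w₀ ≫ s₀ ≫ w₀ = c • 𝟙 _ := by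
    rw [hc, Linear.smul_comp, Linear.comp_smul, Category.id_comp, h₀.unitary.2]
  have hleft : ∀ X : C, (λ_ (G.obj X)).hom =
      w₀ ▷ G.obj X ≫ w (𝟙_ C) X ≫ G.map (λ_ X).hom := by
    intro X
    have h1 := (h₀.whiskerRight (G.obj X)).comp (h (𝟙_ C) X) (by
      rw [dag_whiskerRight, ← comp_whiskerRight, ← comp_whiskerRight, hscal,
        MonoidalLinear.smul_whiskerRight, id_whiskerRight, Linear.smul_comp, Linear.comp_smul,
        Category.id_comp, Category.comp_id])
    have h2 := h1.comp_unitary (hGu (UnitaryFusionCategory.leftUnitor_unitary X))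
    have h3 := left_unitality G X
    rw [← Category.assoc] at h3
    rw [← h3] at h2
    -- The unitor of the target category is already unitary, hence its own unitary part; the other
    -- side of the old unit diagram has the unitary part computed in `h2`.
    simpa only [Category.assoc] using (IsPolar.of_unitary
      (UnitaryFusionCategory.leftUnitor_unitary (G.obj X))).unique h2
  have hright : ∀ X : C, (ρ_ (G.obj X)).hom =
      G.obj X ◁ w₀ ≫ w X (𝟙_ C) ≫ G.map (ρ_ X).hom := by
    intro X
    have h1 := (h₀.whiskerLeft (G.obj X)).comp (h X (𝟙_ C)) (by
      rw [dag_whiskerLeft, ← MonoidalCategory.whiskerLeft_comp,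
        ← MonoidalCategory.whiskerLeft_comp, hscal,
        MonoidalLinear.whiskerLeft_smul, MonoidalCategory.whiskerLeft_id, Linear.smul_comp,
        Linear.comp_smul, Category.id_comp, Category.comp_id])
    have h2 := h1.comp_unitary (hGu (UnitaryFusionCategory.rightUnitor_unitary X))
    have h3 := right_unitality G X
    rw [← Category.assoc] at h3
    rw [← h3] at h2
    simpa only [Category.assoc] using (IsPolar.of_unitary
      (UnitaryFusionCategory.rightUnitor_unitary (G.obj X))).unique h2
  let M : G.CoreMonoidal :=
    { εIso := ⟨w₀, dag w₀, h₀.unitary.1, h₀.unitary.2⟩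
      μIso := fun X Y => ⟨w X Y, dag (w X Y), (h X Y).unitary.1, (h X Y).unitary.2⟩
      μIso_hom_natural_left := fun {X Y} f Z =>
        (h X Z).natural_unitary (h Y Z) (hl f Z) (hl' f Z)
      μIso_hom_natural_right := fun {X Y} Z f =>
        (h Z X).natural_unitary (h Z Y) (hr Z f) (hr' Z f)
      associativity := hα
      left_unitality := hleft
      right_unitality := hright }
  exact ⟨M.toMonoidal, fun X Y => (h X Y).unitary, h₀.unitary⟩

/-! ### From monoidal equivalence to unitary equivalence. -/

/-- Unitary fusion categories that are equivalent as monoidal categories are unitarily equivalent. -/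
theorem MonoidallyEquivalent.unitarily {C : Type u₁} [Category.{v₁} C] [Preadditive C] [Linear ℂ C]
    [MonoidalCategory C] [DaggerCategory C] [UnitaryFusionCategory C]
    {D : Type u₂} [Category.{v₂} D] [Preadditive D] [Linear ℂ D]
    [MonoidalCategory D] [DaggerCategory D] [UnitaryFusionCategory D]
    (h : MonoidallyEquivalent C D) : UnitarilyMonoidallyEquivalent C D := by
  obtain ⟨F, _, _, _, _⟩ := h
  have : ∀ X Y : D, FiniteDimensional ℂ (X ⟶ Y) := finiteDimensional_hom
  obtain ⟨G, e, hadd, hlin, hG⟩ := exists_iso_dagger_functor F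
  -- The monoidal structure carried over along `e` need not be unitary; it only supplies the
  -- isomorphisms whose unitary parts are taken next.
  let _ : G.Monoidal := Functor.Monoidal.transport e
  have : G.IsEquivalence := Functor.isEquivalence_of_iso e
  obtain ⟨M, hμ, hε⟩ := exists_unitary_monoidal G hG
  exact ⟨G, M, this, hadd, hlin, hG, hμ, hε⟩

theorem MonoidallyEquivalent.symm {C : Type u₁} [Category.{v₁} C] [Preadditive C] [Linear ℂ C]
    [MonoidalCategory C] {D : Type u₂} [Category.{v₂} D] [Preadditive D] [Linear ℂ D]
    [MonoidalCategory D] (h : MonoidallyEquivalent C D) : MonoidallyEquivalent D C := by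
  obtain ⟨F, hF, _, _, _⟩ := h
  let e := F.asEquivalence
  let _ : e.functor.Monoidal := hF
  have : e.functor.Additive := ‹F.Additive›
  have : e.functor.Linear ℂ := ‹F.Linear ℂ›
  exact ⟨e.inverse, e.inverseMonoidal, inferInstance, inferInstance, inferInstance⟩

theorem MonoidallyEquivalent.trans {C : Type u₁} [Category.{v₁} C] [Preadditive C] [Linear ℂ C]
    [MonoidalCategory C] {D : Type u₂} [Category.{v₂} D] [Preadditive D] [Linear ℂ D]
    [MonoidalCategory D] {E : Type u} [Category.{v} E] [Preadditive E] [Linear ℂ E]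
    [MonoidalCategory E] (h : MonoidallyEquivalent C D) (h' : MonoidallyEquivalent D E) :
    MonoidallyEquivalent C E := by
  obtain ⟨F, _, _, _, _⟩ := h
  obtain ⟨G, _, _, _, _⟩ := h'
  exact ⟨F ⋙ G, inferInstance, inferInstance, inferInstance, inferInstance⟩

end TambaraYamagami

end

theorem theoremA1 {A : Type u} [CommGroup A] [Fintype A] [DecidableEq A] (d : TYData A)
    (C : Type u₁) [CategoryTheory.Category.{v₁} C] [CategoryTheory.Preadditive C]
    [CategoryTheory.Linear ℂ C] [CategoryTheory.MonoidalCategory C] [DaggerCategory C]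
    [UnitaryFusionCategory C]
    (D : Type u₂) [CategoryTheory.Category.{v₂} D] [CategoryTheory.Preadditive D]
    [CategoryTheory.Linear ℂ D] [CategoryTheory.MonoidalCategory D] [DaggerCategory D]
    [UnitaryFusionCategory D]
    (hC : MonoidallyEquivalent C d.TY) (hD : MonoidallyEquivalent D d.TY) :
    UnitarilyMonoidallyEquivalent C D :=
  (hC.trans hD.symm).unitarily
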